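/- Let $n,m\ge 1$. Cubes in $\mathbb{R}^n$ are nondegenerate with sides parallel to the axes; $\mathcal{Q}$ is the family of all cubes, $\mathcal{D}=\{2^{-k}(j+[0,1)^n):k\in\mathbb{Z},\,j\in\mathbb{Z}^n\}$ is the family of dyadic cubes, $|E|$ is the Lebesgue measure of $E$. A family $\mathcal{S}\subset\mathcal{D}$ is *sparse* if there are pairwise disjoint measurable sets $E_{\mathcal S}(S)\subset S$, $S\in\mathcal{S}$, with $2|E_{\mathcal S}(S)|\ge|S|$. A *weight* $w$ is a nonnegative locally integrable function on $\mathbb{R}^n$; for such $w$ and $s>0$ write $w^s(Q)=\int_Q w^s\,dx$. For $1<q<\infty$ set $[w]_{A_q}=\sup_{Q\in\mathcal Q}\big(\frac1{|Q|}\int_Q w\,dx\big)\big(\frac1{|Q|}\int_Q w^{-1/(q-1)}\,dx\big)^{q-1}$, and write $w\in A_\infty$ if $[w]_{A_\infty}=\lim_{q\to\infty}[w]_{A_q}<\infty$. Let $p_1,\dots,p_m\in(1,\infty)$, $\vec P=(p_1,\dots,p_m)$, $1/p=1/p_1+\cdots+1/p_m$, and let $1<p\le p_0<\infty$. For a weight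 $\mu$, a nonnegative measurable function $g$ with values in $[0,\infty]$, and $\vec f=(f_1,\dots,f_m)$ with each $f_i$ locally integrable, put $$\|g\|_{\mathcal{M}_\mu^{p,p_0}}=\sup_{Q\in\mathcal{Q}}|Q|^{\frac1{p_0}-\frac1p}\Big(\int_Q g^p\,\mu\,dx\Big)^{1/p},\qquad \|\vec f\|_{\mathcal{M}^{\vec P,p_0}}=\sup_{Q\in\mathcal{Q}}|Q|^{\frac1{p_0}}\prod_{i=1}^m\Big(\frac1{|Q|}\int_Q|f_i|^{p_i}\,dx\Big)^{1/p_i},$$ with the conventions $0\cdot\infty=0$ and $0^{-s}=\infty$ for $s>0$. **Theorem.** Let $\mu$ be a weight on $\mathbb{R}^n$, let $\mathcal{S}\subset\mathcal{D}$ be a sparse family, and let $K:\mathcal{D}\to[0,\infty)$ satisfy, for some constant $B<\infty$, $$\sum_{Q'\in\mathcal{D}:\,Q'\supsetneq Q}K(Q')|Q'|^{m-1/p_0}\le B\,K(Q)|Q|^{m-1/p_0}\qquad\text{for all }Q\in\mathcal{D}.\tag{D}$$ For nonnegative locally integrable $f_1,\dots,f_m$ define $\mathfrak{I}_K^{\mathcal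 S}(\vec f)=\sum_{S\in\mathcal{S}}K(S)\Big(\prod_{i=1}^m\int_S f_i\,dx\Big)\mathbf{1}_S$. Then $$\|\mathfrak{I}_K^{\mathcal S}(\vec f)\|_{\mathcal{M}_\mu^{p,p_0}}\le C\,A_0\,\|\vec f\|_{\mathcal{M}^{\vec P,p_0}}$$ for all such $\vec f$, in each of the following two cases: (a) $\mu\in A_\infty$ and $A_0=\sup_{Q\in\mathcal{D}}K(Q)|Q|^m\Big(\frac{\mu(Q)}{|Q|}\Big)^{1/p}<\infty$; here $C<\infty$ depends only on $n,m,\vec P,p_0,B$ and $[\mu]_{A_\infty}$. (b) $r>1$ and $A_0=\sup_{Q\in\mathcal{D}}K(Q)|Q|^m\Big(\frac{\mu^r(Q)}{|Q|}\Big)^{\frac1{rp}}<\infty$; here $C<\infty$ depends only on $n,m,\vec P,p_0,B$ and $r$. -/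

import Mathlib

open Set Filter Topology MeasureTheory
open scoped ENNReal NNReal

noncomputable section

namespace ProductMorrey

/-- The axis-parallel cube `∏ᵢ [aᵢ, aᵢ + ℓ)` in `ℝⁿ` with lower corner `a` and side length `ℓ`.
Only Lebesgue measure and measures with a density with respect to it are integrated over cubes
below, so it makes no difference which boundary points belong to a cube. -/
def cube {n : ℕ} (a : Fin n → ℝ) (ℓ : ℝ) : Set (Fin n → ℝ) :=
  {x | ∀ i, a i ≤ x i ∧ x i < a i + ℓ}

/-- The family of all (nondegenerate) cubes in `ℝⁿ` with sides parallel to the axes. -/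
def cubes (n : ℕ) : Set (Set (Fin n → ℝ)) :=
  {Q | ∃ (a : Fin n → ℝ) (ℓ : ℝ), 0 < ℓ ∧ Q = cube a ℓ}

/-- The family `{2⁻ᵏ (j + [0,1)ⁿ) : k ∈ ℤ, j ∈ ℤⁿ}` of dyadic cubes in `ℝⁿ`. -/
def dyadicCubes (n : ℕ) : Set (Set (Fin n → ℝ)) :=
  {Q | ∃ (k : ℤ) (j : Fin n → ℤ),
    Q = cube (fun i => (2 : ℝ) ^ (-k) * (j i : ℝ)) ((2 : ℝ) ^ (-k))}

/-- A family of dyadic cubes is sparse if its members `Q` have pairwise disjoint measurable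
subsets `E Q` with `2 |E Q| ≥ |Q|`. -/
def IsSparse {n : ℕ} (S : Set (dyadicCubes n)) : Prop :=
  ∃ E : dyadicCubes n → Set (Fin n → ℝ),
    (∀ Q ∈ S, MeasurableSet (E Q) ∧ E Q ⊆ (Q : Set (Fin n → ℝ)) ∧
      volume (Q : Set (Fin n → ℝ)) ≤ 2 * volume (E Q)) ∧
    S.PairwiseDisjoint E

/-- Nonnegative locally integrable functions on `ℝⁿ`, that is, weights. -/
structure IsWeight {n : ℕ} (w : (Fin n → ℝ) → ℝ) : Prop where
  nonneg : ∀ x, 0 ≤ w x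
  locallyIntegrable : LocallyIntegrable w volume

/-- The Muckenhoupt constant
`[w]_{A_q} = sup_Q (⨍_Q w) (⨍_Q w^(-1/(q-1)))^(q-1)`, for `1 < q < ∞`, as an extended number. -/
def apConst {n : ℕ} (q : ℝ) (w : (Fin n → ℝ) → ℝ) : ℝ≥0∞ :=
  ⨆ Q ∈ cubes n, (⨍⁻ x in Q, ENNReal.ofReal (w x) ∂volume) *
    (⨍⁻ x in Q, ENNReal.ofReal (w x) ^ (-(1 / (q - 1))) ∂volume) ^ (q - 1)

/-- The weight `w` belongs to `A_∞`, and `[w]_{A_∞} = lim_{q → ∞} [w]_{A_q}` is the finite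
number `L`. -/
def HasAInftyConst {n : ℕ} (w : (Fin n → ℝ) → ℝ) (L : ℝ≥0) : Prop :=
  Tendsto (fun q : ℝ => apConst q w) atTop (𝓝 (L : ℝ≥0∞))

/-- The measure `μ dx` of a weight `μ`. -/
def weightMeasure {n : ℕ} (μ : (Fin n → ℝ) → ℝ) : Measure (Fin n → ℝ) :=
  volume.withDensity fun x => ENNReal.ofReal (μ x)

/-- The norm `sup_Q |Q|^(1/q₀ - 1/q) (∫_Q g^q dν)^(1/q)` of a nonnegative function `g` in the
Morrey space `M_ν^{q,q₀}`; here `|Q|` is the Lebesgue measure of `Q`. -/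
def morreyNorm {n : ℕ} (ν : Measure (Fin n → ℝ)) (q q₀ : ℝ) (g : (Fin n → ℝ) → ℝ≥0∞) : ℝ≥0∞ :=
  ⨆ Q ∈ cubes n, volume Q ^ (1 / q₀ - 1 / q) * (∫⁻ x in Q, g x ^ q ∂ν) ^ (1 / q)

/-- The norm `sup_Q |Q|^(1/p₀) ∏ᵢ (⨍_Q |fᵢ|^(pᵢ) dx)^(1/pᵢ)` of `f = (f₁, …, f_m)` in the
product Morrey space `M^{P,p₀}`. -/
def productMorreyNorm {n m : ℕ} (P : Fin m → ℝ) (p₀ : ℝ) (f : Fin m → (Fin n → ℝ) → ℝ) : ℝ≥0∞ :=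
  ⨆ Q ∈ cubes n, volume Q ^ (1 / p₀) *
    ∏ i, (⨍⁻ x in Q, ENNReal.ofReal |f i x| ^ P i ∂volume) ^ (1 / P i)

/-- The operator `∑_{Q ∈ S} K(Q) (∏ᵢ ∫_Q fᵢ dx) 1_Q`, for nonnegative `f₁, …, f_m`. -/
def sparseOperator {n m : ℕ} (K : dyadicCubes n → ℝ≥0) (S : Set (dyadicCubes n))
    (f : Fin m → (Fin n → ℝ) → ℝ) (x : Fin n → ℝ) : ℝ≥0∞ :=
  ∑' Q : S, ((K Q.1 : ℝ≥0∞) * ∏ i, ∫⁻ y in (Q.1 : Set (Fin n → ℝ)), ENNReal.ofReal (f i y)) *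
    (Q.1 : Set (Fin n → ℝ)).indicator (fun _ => (1 : ℝ≥0∞)) x

/-- Condition (D) with constant `B`: for every dyadic cube `Q`, the sum of
`K(Q') |Q'|^(m - 1/p₀)` over all dyadic cubes `Q'` strictly containing `Q` is at most
`B K(Q) |Q|^(m - 1/p₀)`. -/
def ConditionD {n : ℕ} (m : ℕ) (p₀ : ℝ) (B : ℝ≥0) (K : dyadicCubes n → ℝ≥0) : Prop :=
  ∀ Q : dyadicCubes n,
    ∑' Q' : {Q' : dyadicCubes n // (Q : Set (Fin n → ℝ)) ⊂ (Q' : Set (Fin n → ℝ))},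
        (K Q'.1 : ℝ≥0∞) * volume (Q'.1 : Set (Fin n → ℝ)) ^ ((m : ℝ) - 1 / p₀) ≤
      (B : ℝ≥0∞) * ((K Q : ℝ≥0∞) * volume (Q : Set (Fin n → ℝ)) ^ ((m : ℝ) - 1 / p₀))

/-- `sup_Q K(Q) |Q|^m (μ(Q) / |Q|)^(1/p)`, over all dyadic cubes `Q`. -/
def testConst {n : ℕ} (m : ℕ) (p : ℝ) (K : dyadicCubes n → ℝ≥0) (μ : (Fin n → ℝ) → ℝ) : ℝ≥0∞ :=
  ⨆ Q : dyadicCubes n, (K Q : ℝ≥0∞) * volume (Q : Set (Fin n → ℝ)) ^ m *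
    ((∫⁻ x in (Q : Set (Fin n → ℝ)), ENNReal.ofReal (μ x)) /
      volume (Q : Set (Fin n → ℝ))) ^ (1 / p)

/-- `sup_Q K(Q) |Q|^m (μ^r(Q) / |Q|)^(1/(rp))`, over all dyadic cubes `Q`, where
`μ^r(Q) = ∫_Q μ^r dx`. -/
def bumpTestConst {n : ℕ} (m : ℕ) (p r : ℝ) (K : dyadicCubes n → ℝ≥0)
    (μ : (Fin n → ℝ) → ℝ) : ℝ≥0∞ :=
  ⨆ Q : dyadicCubes n, (K Q : ℝ≥0∞) * volume (Q : Set (Fin n → ℝ)) ^ m *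
    ((∫⁻ x in (Q : Set (Fin n → ℝ)), ENNReal.ofReal (μ x) ^ r) /
      volume (Q : Set (Fin n → ℝ))) ^ (1 / (r * p))

end ProductMorrey

end

namespace ProductMorrey

/-! An arbitrary cube is covered by boundedly many dyadic cubes of comparable size, so the Morrey
norm need only be tested on a dyadic cube Q (`morreyNorm_le_of_dyadic`). On Q the operator splits,
by nestedness, into the cubes strictly containing Q and the cubes of the sparse family inside Q
(`sparseOperator_le_add`).

The outer part is constant on Q. Hölder bounds each product of integrals by the product Morrey norm
times a power of |R|, condition (D) sums these bounds back to Q, and the testing constant at Q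
absorbs what is left (`tsum_ssuperset_le`).

The inner part satisfies a local strong type bound, obtained by pairing with g in L^q(μ), where q is
conjugate to p. Suppose that K(R)|R|^m ∫_R g dμ is at most A₀ |R|^{1/p} y_R with the ℓ^q norm of y
controlled by the norm of g. Then Hölder in ℓ^p and ℓ^q leaves the sum of |R| ∏ ⟨f_i⟩_R^p, which a
second Hölder inequality and the Carleson embedding for each f_i bound
(`sum_volume_mul_prod_average_le`).

The two cases differ only in how y is produced. In (a), the A_∞ condition gives E(R) a fixed
fraction of the μ-mass of R, and the Carleson embedding is applied with respect to μ. In (b), Hölder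
with exponents rp and t = (rp)' detaches the bump of μ; since t < q, the Carleson embedding for
Lebesgue measure applies with exponent q/t > 1. -/

/-! ### Finite families of nested sets -/

theorem exists_disjoint_subfamily {ι α : Type*} (s : ι → Set α) (F : Finset ι)
    (hs : ∀ i ∈ F, ∀ j ∈ F, s i ⊆ s j ∨ s j ⊆ s i ∨ Disjoint (s i) (s j)) :
    ∃ G ⊆ F, (G : Set ι).PairwiseDisjoint s ∧ ⋃ i ∈ G, s i = ⋃ i ∈ F, s i := by
  classical
  induction F using Finset.induction_on with
  | empty => exact ⟨∅, by simp⟩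
  | insert a F ha ih =>
    obtain ⟨G, hGF, hd, hU⟩ := ih fun i hi j hj =>
      hs i (Finset.mem_insert_of_mem hi) j (Finset.mem_insert_of_mem hj)
    by_cases hsub : ∃ j ∈ G, s a ⊆ s j
    · obtain ⟨j, hj, hj'⟩ := hsub
      refine ⟨G, hGF.trans (Finset.subset_insert _ _), hd, ?_⟩
      rw [Finset.set_biUnion_insert, ← hU, eq_comm, union_eq_right]
      exact hj'.trans (subset_biUnion_of_mem (u := s) hj)
    · push Not at hsub
      -- Members swallowed by `s a` are dropped. A survivor neither contains `s a` nor lies in it,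
      -- so nestedness makes the two disjoint.
      refine ⟨insert a (G.filter fun j => ¬ s j ⊆ s a), ?_, ?_, ?_⟩
      · exact Finset.insert_subset_insert _ ((Finset.filter_subset _ _).trans hGF)
      · rw [Finset.coe_insert]
        refine PairwiseDisjoint.insert
          (hd.subset (by exact_mod_cast Finset.filter_subset _ _)) fun j hj _ => ?_
        have hj := Finset.mem_filter.1 (Finset.mem_coe.1 hj)
        rcases hs a (Finset.mem_insert_self _ _) j (Finset.mem_insert_of_mem (hGF hj.1)) with
          h | h | h
        · exact absurd h (hsub j hj.1)
        · exact absurd h hj.2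
        · exact h
      · rw [Finset.set_biUnion_insert, Finset.set_biUnion_insert, ← hU]
        ext x
        simp only [mem_union, mem_iUnion, Finset.mem_filter, exists_prop]
        constructor
        · rintro (h | ⟨j, hj, hx⟩)
          · exact Or.inl h
          · exact Or.inr ⟨j, hj.1, hx⟩
        · rintro (h | ⟨j, hj, hx⟩)
          · exact Or.inl h
          · by_cases h : s j ⊆ s a
            · exact Or.inl (h hx)
            · exact Or.inr ⟨j, ⟨hj, h⟩, hx⟩

/-! ### Carleson embedding, duality and Hölder for finite families -/

section

variable {ι α : Type*} [MeasurableSpace α]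

/-- Passing to a disjoint subfamily with the same union makes the inequality additive, so no overlap
constant is lost. Applied to superlevel sets, this is the weak type bound for the dyadic maximal
function. -/
theorem mul_measure_biUnion_le_of_nested {s : ι → Set α} {F : Finset ι}
    (hs : ∀ i ∈ F, ∀ j ∈ F, s i ⊆ s j ∨ s j ⊆ s i ∨ Disjoint (s i) (s j))
    (hm : ∀ i ∈ F, MeasurableSet (s i)) {ν ρ : Measure α} {t : ℝ≥0∞}
    (h : ∀ i ∈ F, t * ν (s i) ≤ ρ (s i)) :
    t * ν (⋃ i ∈ F, s i) ≤ ρ (⋃ i ∈ F, s i) := by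
  obtain ⟨G, hGF, hd, hU⟩ := exists_disjoint_subfamily s F hs
  rw [← hU, measure_biUnion_finset hd fun i hi => hm i (hGF hi),
    measure_biUnion_finset hd fun i hi => hm i (hGF hi), Finset.mul_sum]
  exact Finset.sum_le_sum fun i hi => h i (hGF hi)

/-- Absorption: the factor `X ^ (1 / q)` is cancelled from both sides, which is where finiteness of
`X` is essential. -/
theorem rpow_inv_le_of_le_mul_rpow {p q : ℝ} (hpq : p.HolderConjugate q) {X D : ℝ≥0∞}
    (hX : X ≠ ∞) (h : X ≤ D * X ^ (1 / q)) : X ^ (1 / p) ≤ D := by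
  rcases eq_or_ne X 0 with rfl | h0
  · rw [ENNReal.zero_rpow_of_pos (one_div_pos.2 hpq.pos)]
    exact zero_le
  · have h1 : X = X ^ (1 / p) * X ^ (1 / q) := by
      rw [← ENNReal.rpow_add _ _ h0 hX, one_div, one_div, hpq.inv_add_inv_eq_one,
        ENNReal.rpow_one]
    rw [h1, ← ENNReal.rpow_add _ _ h0 hX, one_div, one_div, hpq.inv_add_inv_eq_one,
      ENNReal.rpow_one] at h
    nth_rewrite 1 [h1] at h
    rw [one_div q] at h
    exact (ENNReal.mul_le_mul_iff_left
      (ENNReal.rpow_pos (pos_iff_ne_zero.2 h0) hX).ne'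
      (ENNReal.rpow_ne_top_of_nonneg (inv_nonneg.2 hpq.symm.nonneg) hX)).1 h

/-- A weak type estimate of Doob's kind implies the strong type estimate. -/
theorem lintegral_rpow_le_of_weak_type {ν : Measure α} {p : ℝ} (hp : 1 < p) {M : α → ℝ≥0}
    (hM : Measurable M) {h : α → ℝ≥0∞} (hh : AEMeasurable h ν)
    (hw : ∀ t : ℝ≥0, 0 < t → t * ν {x | t < M x} ≤ ∫⁻ x in {x | t < M x}, h x ∂ν)
    (hfin : ∫⁻ x, (M x : ℝ≥0∞) ^ p ∂ν ≠ ∞) :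
    ∫⁻ x, (M x : ℝ≥0∞) ^ p ∂ν ≤ ENNReal.ofReal (p / (p - 1)) ^ p * ∫⁻ x, h x ^ p ∂ν := by
  have hp0 : 0 < p := by linarith
  have hp1 : 0 < p - 1 := by linarith
  have hpq : p.HolderConjugate (p / (p - 1)) := Real.HolderConjugate.conjExponent hp
  have hcoe : ∀ s : ℝ, 0 ≤ s → ∀ x, (M x : ℝ≥0∞) ^ s = ENNReal.ofReal ((M x : ℝ) ^ s) := by
    intro s hs x
    rw [← ENNReal.ofReal_rpow_of_nonneg (M x).coe_nonneg hs, ENNReal.ofReal_coe_nnreal]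
  set ρ := ν.withDensity h
  have hMr : Measurable fun x => (M x : ℝ) := measurable_coe_nnreal_real.comp hM
  have h1 : ∫⁻ x, (M x : ℝ≥0∞) ^ p ∂ν ≤
      ENNReal.ofReal (p / (p - 1)) * ∫⁻ x, (M x : ℝ≥0∞) ^ (p - 1) ∂ρ := by
    -- Layer-cake formulas on both sides have densities p t^{p-1} and (p-1) t^{p-2}. The weak type
    -- bound consumes the extra t, and the ratio p/(p-1) is the constant.
    simp_rw [hcoe p hp0.le, hcoe (p - 1) hp1.le]
    rw [lintegral_rpow_eq_lintegral_meas_lt_mul ν (ae_of_all _ fun x => (M x).coe_nonneg)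
        hMr.aemeasurable hp0,
      lintegral_rpow_eq_lintegral_meas_lt_mul ρ (ae_of_all _ fun x => (M x).coe_nonneg)
        hMr.aemeasurable hp1, ← mul_assoc, ← ENNReal.ofReal_mul (div_pos hp0 hp1).le,
      div_mul_cancel₀ _ hp1.ne']
    refine mul_le_mul_right (setLIntegral_mono' measurableSet_Ioi fun t ht => ?_) _
    have ht : 0 < t := ht
    have hset : {a | t < (M a : ℝ)} = {a | t.toNNReal < M a} := by
      ext a
      rw [mem_ofPred_eq, mem_ofPred_eq, Real.toNNReal_lt_iff_lt_coe ht.le]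
    rw [hset, show t ^ (p - 1) = t * t ^ (p - 1 - 1) by
      rw [Real.rpow_sub_one ht.ne' (p - 1)]; field_simp, ENNReal.ofReal_mul ht.le, ← mul_assoc]
    refine mul_le_mul_left ?_ _
    rw [mul_comm]
    refine (hw t.toNNReal (by simpa using ht)).trans ?_
    rw [withDensity_apply _ (measurableSet_lt measurable_const hM)]
  have h2 : ∫⁻ x, (M x : ℝ≥0∞) ^ (p - 1) ∂ρ ≤
      (∫⁻ x, h x ^ p ∂ν) ^ (1 / p) * (∫⁻ x, (M x : ℝ≥0∞) ^ p ∂ν) ^ (1 / (p / (p - 1))) := by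
    have hMe : Measurable fun x => (M x : ℝ≥0∞) ^ (p - 1) :=
      (measurable_coe_nnreal_ennreal.comp hM).pow_const _
    rw [lintegral_withDensity_eq_lintegral_mul₀ hh hMe.aemeasurable]
    refine (ENNReal.lintegral_mul_le_Lp_mul_Lq ν hpq hh hMe.aemeasurable).trans_eq ?_
    simp_rw [← ENNReal.rpow_mul, mul_div_cancel₀ p hp1.ne']
  have h3 := rpow_inv_le_of_le_mul_rpow hpq hfin
    ((h1.trans (mul_le_mul_right h2 _)).trans_eq (mul_assoc _ _ _).symm)
  have h4 := ENNReal.rpow_le_rpow h3 hp0.le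
  rwa [← ENNReal.rpow_mul, one_div_mul_cancel hp0.ne', ENNReal.rpow_one,
    ENNReal.mul_rpow_of_nonneg _ _ hp0.le, ← ENNReal.rpow_mul, one_div_mul_cancel hp0.ne',
    ENNReal.rpow_one] at h4

theorem lintegral_rpow_le_measure_mul {ν : Measure α} {s : Set α} {p : ℝ} (hp : 1 < p)
    {h : α → ℝ≥0∞} (hh : AEMeasurable h ν) :
    ∫⁻ x in s, h x ∂ν ≤ ν s ^ (1 - 1 / p) * (∫⁻ x in s, h x ^ p ∂ν) ^ (1 / p) := by
  have hpq : p.HolderConjugate (p / (p - 1)) := Real.HolderConjugate.conjExponent hp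
  have := ENNReal.lintegral_mul_le_Lp_mul_Lq (ν.restrict s) hpq hh.restrict
    (aemeasurable_const (b := (1 : ℝ≥0∞)))
  have e : 1 / (p / (p - 1)) = 1 - 1 / p := by
    have := hpq.inv_add_inv_eq_one
    rw [one_div, one_div]; linarith
  simpa [e, mul_comm] using this

/-- The dyadic Carleson embedding theorem for finite nested families. -/
theorem carleson_embedding {ν : Measure α} {s E : ι → Set α} {F : Finset ι} {p : ℝ} (hp : 1 < p)
    (hs : ∀ i ∈ F, ∀ j ∈ F, s i ⊆ s j ∨ s j ⊆ s i ∨ Disjoint (s i) (s j))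
    (hm : ∀ i ∈ F, MeasurableSet (s i)) (hfin : ∀ i ∈ F, ν (s i) ≠ ∞)
    (hE : ∀ i ∈ F, MeasurableSet (E i) ∧ E i ⊆ s i) (hd : (F : Set ι).PairwiseDisjoint E)
    {h : α → ℝ≥0∞} (hh : AEMeasurable h ν) :
    ∑ i ∈ F, ν (E i) * ((∫⁻ x in s i, h x ∂ν) / ν (s i)) ^ p ≤
      ENNReal.ofReal (p / (p - 1)) ^ p * ∫⁻ x, h x ^ p ∂ν := by
  classical
  have hp0 : 0 < p := by linarith
  have hc : ENNReal.ofReal (p / (p - 1)) ^ p ≠ 0 := by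
    refine (ENNReal.rpow_pos (ENNReal.ofReal_pos.2 (div_pos hp0 (by linarith)))
      ENNReal.ofReal_ne_top).ne'
  by_cases htop : ∫⁻ x, h x ^ p ∂ν = ∞
  · rw [htop, ENNReal.mul_top hc]
    exact le_top
  have hint : ∀ i ∈ F, ∫⁻ x in s i, h x ∂ν ≠ ∞ := fun i hi =>
    ((lintegral_rpow_le_measure_mul hp hh).trans_lt (ENNReal.mul_lt_top
      (ENNReal.rpow_lt_top_of_nonneg (by rw [sub_nonneg, div_le_one hp0]; exact hp.le) (hfin i hi))
      (ENNReal.rpow_lt_top_of_nonneg (by positivity)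
        (ne_top_of_le_ne_top htop (setLIntegral_le_lintegral _ _))))).ne
  set a : ι → ℝ≥0 := fun i => ((∫⁻ x in s i, h x ∂ν) / ν (s i)).toNNReal with ha
  have hle : ∀ i ∈ F, (a i : ℝ≥0∞) * ν (s i) ≤ ∫⁻ x in s i, h x ∂ν := fun i hi =>
    by
    rw [mul_comm]
    exact (mul_le_mul_right ENNReal.coe_toNNReal_le_self _).trans ENNReal.mul_div_le
  -- The maximal function of the finite family: its superlevel sets are unions of members, and on `E
  -- i` it dominates the average over `s i`. Finiteness of the family makes its p-th power
  -- integrable.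
  set M : α → ℝ≥0 := fun x => F.sup fun i => (s i).indicator (fun _ => a i) x with hM
  have hMlt : ∀ t : ℝ≥0, {x | t < M x} = ⋃ i ∈ F.filter fun i => t < a i, s i := by
    intro t
    ext x
    simp only [mem_ofPred_eq, hM, Finset.lt_sup_iff, mem_iUnion, Finset.mem_filter, exists_prop]
    constructor
    · rintro ⟨i, hi, hx⟩
      by_cases hxi : x ∈ s i
      · rw [indicator_of_mem hxi] at hx
        exact ⟨i, ⟨hi, hx⟩, hxi⟩
      · rw [indicator_of_notMem hxi] at hx
        exact absurd hx not_lt_zero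
    · rintro ⟨i, ⟨hi, hx⟩, hxi⟩
      exact ⟨i, hi, by rwa [indicator_of_mem hxi]⟩
  have hMm : Measurable M := measurable_of_Ioi fun t => by
    change MeasurableSet {x | t < M x}
    rw [hMlt]
    exact Finset.measurableSet_biUnion _ fun i hi => hm i (Finset.mem_filter.1 hi).1
  have hMfin : ∫⁻ x, (M x : ℝ≥0∞) ^ p ∂ν ≠ ∞ := by
    have : ∀ x, (M x : ℝ≥0∞) ^ p ≤ ∑ i ∈ F, (s i).indicator (fun _ => (a i : ℝ≥0∞) ^ p) x := by
      intro x
      rcases F.eq_empty_or_nonempty with rfl | hF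
      · simp [hM, hp0]
      · obtain ⟨i, hi, hix⟩ := Finset.exists_mem_eq_sup F hF fun i =>
          (s i).indicator (fun _ => a i) x
        refine le_trans ?_ (Finset.single_le_sum (f := fun i =>
          (s i).indicator (fun _ => (a i : ℝ≥0∞) ^ p) x) (fun _ _ => zero_le) hi)
        simp only [hM, hix]
        by_cases hxi : x ∈ s i
        · simp [hxi]
        · simp [hxi, hp0]
    refine ((lintegral_mono this).trans_lt ?_).ne
    rw [lintegral_finsetSum' _ fun i hi => (measurable_const.indicator (hm i hi)).aemeasurable]
    refine ENNReal.sum_lt_top.2 fun i hi => ?_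
    rw [lintegral_indicator_const (hm i hi)]
    exact ENNReal.mul_lt_top (ENNReal.rpow_lt_top_of_nonneg hp0.le ENNReal.coe_ne_top)
      (hfin i hi).lt_top
  refine le_trans ?_ (lintegral_rpow_le_of_weak_type hp hMm hh (fun t _ => ?_) hMfin)
  · calc ∑ i ∈ F, ν (E i) * ((∫⁻ x in s i, h x ∂ν) / ν (s i)) ^ p
        ≤ ∑ i ∈ F, ∫⁻ x in E i, (M x : ℝ≥0∞) ^ p ∂ν := by
          refine Finset.sum_le_sum fun i hi => ?_
          by_cases h0 : ν (s i) = 0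
          · rw [measure_mono_null (hE i hi).2 h0, zero_mul]
            exact zero_le
          · rw [mul_comm, ← setLIntegral_const]
            refine setLIntegral_mono' (hE i hi).1 fun x hx => ENNReal.rpow_le_rpow ?_ hp0.le
            rw [← ENNReal.coe_toNNReal (ENNReal.div_ne_top (hint i hi) h0), ENNReal.coe_le_coe]
            refine le_trans ?_ (Finset.le_sup (f := fun i => (s i).indicator (fun _ => a i) x) hi)
            rw [indicator_of_mem ((hE i hi).2 hx)]
      _ = ∫⁻ x in ⋃ i ∈ F, E i, (M x : ℝ≥0∞) ^ p ∂ν :=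
          (lintegral_biUnion_finset hd (fun i hi => (hE i hi).1) _).symm
      _ ≤ _ := setLIntegral_le_lintegral _ _
  · rw [hMlt, ← withDensity_apply _ (Finset.measurableSet_biUnion _ fun i hi =>
      hm i (Finset.mem_filter.1 hi).1)]
    refine mul_measure_biUnion_le_of_nested
      (fun i hi j hj => hs i (Finset.mem_filter.1 hi).1 j (Finset.mem_filter.1 hj).1)
      (fun i hi => hm i (Finset.mem_filter.1 hi).1) fun i hi => ?_
    obtain ⟨hi, hti⟩ := Finset.mem_filter.1 hi
    rw [withDensity_apply _ (hm i hi)]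
    exact (mul_le_mul_left (by exact_mod_cast hti.le) _).trans (hle i hi)

/-- Restricting the measure to `Q` changes nothing for sets inside `Q`, so the global embedding
localises. -/
theorem carleson_embedding_subset {ν : Measure α} {s E : ι → Set α} {F : Finset ι} {p : ℝ}
    (hp : 1 < p)
    (hs : ∀ i ∈ F, ∀ j ∈ F, s i ⊆ s j ∨ s j ⊆ s i ∨ Disjoint (s i) (s j))
    (hm : ∀ i ∈ F, MeasurableSet (s i)) (hfin : ∀ i ∈ F, ν (s i) ≠ ∞)
    (hE : ∀ i ∈ F, MeasurableSet (E i) ∧ E i ⊆ s i) (hd : (F : Set ι).PairwiseDisjoint E)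
    {h : α → ℝ≥0∞} (hh : AEMeasurable h ν) {Q : Set α} (hQ : ∀ i ∈ F, s i ⊆ Q) :
    ∑ i ∈ F, ν (E i) * ((∫⁻ x in s i, h x ∂ν) / ν (s i)) ^ p ≤
      ENNReal.ofReal (p / (p - 1)) ^ p * ∫⁻ x in Q, h x ^ p ∂ν := by
  refine le_trans (Finset.sum_le_sum fun i hi => ?_)
    (carleson_embedding (ν := ν.restrict Q) hp hs hm (fun i hi => ?_) hE hd hh.restrict)
  · rw [Measure.restrict_restrict (hm i hi), inter_eq_left.2 (hQ i hi),
      Measure.restrict_apply (hm i hi), Measure.restrict_apply (hE i hi).1,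
      inter_eq_left.2 (hQ i hi), inter_eq_left.2 ((hE i hi).2.trans (hQ i hi))]
  · rw [Measure.restrict_apply (hm i hi), inter_eq_left.2 (hQ i hi)]
    exact hfin i hi

/-- Duality for finite positive combinations of indicator functions. -/
theorem lintegral_sum_indicator_rpow_le {ν : Measure α} {s : ι → Set α} {F : Finset ι}
    {p q : ℝ} (hpq : p.HolderConjugate q) (hm : ∀ i ∈ F, MeasurableSet (s i))
    (hfin : ∀ i ∈ F, ν (s i) ≠ ∞) {a : ι → ℝ≥0∞} (ha : ∀ i ∈ F, a i ≠ ∞) {D : ℝ≥0∞}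
    (h : ∀ g : α → ℝ≥0∞, Measurable g →
      ∑ i ∈ F, a i * ∫⁻ x in s i, g x ∂ν ≤ D * (∫⁻ x, g x ^ q ∂ν) ^ (1 / q)) :
    (∫⁻ x, (∑ i ∈ F, a i * (s i).indicator (fun _ => (1 : ℝ≥0∞)) x) ^ p ∂ν) ^ (1 / p) ≤ D := by
  set T : α → ℝ≥0∞ := fun x => ∑ i ∈ F, a i * (s i).indicator (fun _ => (1 : ℝ≥0∞)) x with hT
  have hind : ∀ i ∈ F, Measurable fun x => (s i).indicator (fun _ => (1 : ℝ≥0∞)) x :=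
    fun i hi => measurable_const.indicator (hm i hi)
  have hTm : Measurable T :=
    Finset.measurable_fun_sum _ fun i hi => (hind i hi).const_mul _
  have hp1 : 0 < p - 1 := hpq.sub_one_pos
  have hTtop : ∀ x, T x ≤ ∑ i ∈ F, a i := fun x => Finset.sum_le_sum fun i _ => by
    by_cases hx : x ∈ s i <;> simp [hx]
  have hsum : ∑ i ∈ F, a i ≠ ∞ := ENNReal.sum_ne_top.2 ha
  have hTU : ∀ x, T x ^ p ≤
      (⋃ i ∈ F, s i).indicator (fun _ => (∑ i ∈ F, a i) ^ p) x := by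
    intro x
    by_cases hx : x ∈ ⋃ i ∈ F, s i
    · rw [indicator_of_mem hx]
      exact ENNReal.rpow_le_rpow (hTtop x) hpq.nonneg
    · have : T x = 0 := Finset.sum_eq_zero fun i hi => by
        rw [indicator_of_notMem, mul_zero]
        exact fun h => hx (mem_biUnion hi h)
      rw [this, ENNReal.zero_rpow_of_pos hpq.pos]
      exact zero_le
  have hX : ∫⁻ x, T x ^ p ∂ν ≠ ∞ := by
    refine ((lintegral_mono hTU).trans_lt ?_).ne
    rw [lintegral_indicator_const (Finset.measurableSet_biUnion _ hm)]
    refine ENNReal.mul_lt_top (ENNReal.rpow_lt_top_of_nonneg hpq.nonneg hsum) ?_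
    exact (measure_biUnion_finset_le _ _).trans_lt (ENNReal.sum_lt_top.2 fun i hi =>
      (hfin i hi).lt_top)
  refine rpow_inv_le_of_le_mul_rpow hpq hX ?_
  -- The extremal test function `T ^ (p - 1)`: the pairing becomes the integral of `T ^ p`, and its
  -- L^q norm is a power of that same integral, ready for absorption.
  have h1 := h (fun x => T x ^ (p - 1)) (hTm.pow_const _)
  simp_rw [← ENNReal.rpow_mul, hpq.sub_one_mul_conj] at h1
  refine le_trans (le_of_eq ?_) h1
  calc ∫⁻ x, T x ^ p ∂ν
      = ∫⁻ x, ∑ i ∈ F, a i * (s i).indicator (fun x => T x ^ (p - 1)) x ∂ν := by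
        refine lintegral_congr fun x => ?_
        have : T x ^ p = T x * T x ^ (p - 1) := by
          nth_rewrite 2 [← ENNReal.rpow_one (T x)]
          rw [← ENNReal.rpow_add_of_nonneg _ _ zero_le_one hp1.le]
          congr 1; ring
        rw [this]
        nth_rewrite 1 [hT]
        rw [Finset.sum_mul]
        refine Finset.sum_congr rfl fun i _ => ?_
        by_cases hx : x ∈ s i <;> simp [hx]
    _ = ∑ i ∈ F, a i * ∫⁻ x in s i, T x ^ (p - 1) ∂ν := by
        rw [lintegral_finsetSum' _ fun i hi =>
          (((hTm.pow_const _).indicator (hm i hi)).const_mul _).aemeasurable]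
        refine Finset.sum_congr rfl fun i hi => ?_
        rw [lintegral_const_mul' _ _ (ha i hi), lintegral_indicator (hm i hi)]

/-- Hölder's inequality for finite sums and several factors. -/
theorem sum_prod_rpow_le {κ : Type*} (F : Finset ι) (G : Finset κ) (x : κ → ι → ℝ≥0∞)
    {θ : κ → ℝ} (hθ : ∀ k ∈ G, 0 ≤ θ k) (hsum : ∑ k ∈ G, θ k = 1) :
    ∑ i ∈ F, ∏ k ∈ G, x k i ^ θ k ≤ ∏ k ∈ G, (∑ i ∈ F, x k i) ^ θ k := by
  -- The sums are integrals against counting measure on the discrete space `F`.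
  let _ : MeasurableSpace F := ⊤
  have := ENNReal.lintegral_prod_norm_pow_le (μ := (Measure.count : Measure F)) G
    (f := fun k i => x k i) (fun k _ => (measurable_from_top).aemeasurable) hsum hθ
  simp_rw [lintegral_count, tsum_fintype] at this
  rw [← Finset.sum_coe_sort F]
  refine this.trans_eq (Finset.prod_congr rfl fun k _ => ?_)
  rw [← Finset.sum_coe_sort F]

end

/-! ### Geometry of cubes and dyadic cubes -/

variable {n m : ℕ}

theorem cube_eq_pi (a : Fin n → ℝ) (ℓ : ℝ) :
    cube a ℓ = pi univ fun i => Ico (a i) (a i + ℓ) := by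
  ext x; simp [cube, Set.mem_pi]

theorem measurableSet_cube (a : Fin n → ℝ) (ℓ : ℝ) : MeasurableSet (cube a ℓ) := by
  rw [cube_eq_pi]
  exact MeasurableSet.univ_pi fun i => measurableSet_Ico

theorem volume_cube (a : Fin n → ℝ) (ℓ : ℝ) : volume (cube a ℓ) = ENNReal.ofReal ℓ ^ n := by
  rw [cube_eq_pi, Real.volume_pi_Ico]
  simp

theorem lintegral_cube_ne_top {f : (Fin n → ℝ) → ℝ} (hf : LocallyIntegrable f volume)
    (a : Fin n → ℝ) (ℓ : ℝ) : ∫⁻ x in cube a ℓ, ENNReal.ofReal (f x) ≠ ∞ := by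
  have hsub : cube a ℓ ⊆ Icc a fun i => a i + ℓ := fun x hx =>
    ⟨fun i => (hx i).1, fun i => (hx i).2.le⟩
  have h := ((hf.integrableOn_isCompact isCompact_Icc).mono_set hsub).hasFiniteIntegral
  refine ne_top_of_le_ne_top h.ne (lintegral_mono fun x => ?_)
  rw [Real.enorm_eq_ofReal_abs]
  exact ENNReal.ofReal_le_ofReal (le_abs_self _)

/-- The dyadic cube `2⁻ᵏ (j + [0,1)ⁿ)`. -/
def dyadicCube (k : ℤ) (j : Fin n → ℤ) : Set (Fin n → ℝ) :=
  cube (fun i => (2 : ℝ) ^ (-k) * (j i : ℝ)) ((2 : ℝ) ^ (-k))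

theorem mem_dyadicCube {k : ℤ} {j : Fin n → ℤ} {x : Fin n → ℝ} :
    x ∈ dyadicCube k j ↔ ∀ i, ⌊(2 : ℝ) ^ k * x i⌋ = j i := by
  refine forall_congr' fun i => ?_
  have h2 : (0 : ℝ) < 2 ^ k := by positivity
  dsimp only
  rw [Int.floor_eq_iff, zpow_neg, inv_mul_eq_div, div_le_iff₀ h2, mul_comm (x i),
    ← one_div, ← add_div, lt_div_iff₀ h2, mul_comm (x i)]

/-- The coarse index of a point is its fine index divided by 2^d and rounded down, hence constant on
each fine cube. -/
theorem dyadicCube_subset_or_disjoint {k k' : ℤ} (hk : k ≤ k') (j j' : Fin n → ℤ) :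
    dyadicCube k' j' ⊆ dyadicCube k j ∨ Disjoint (dyadicCube k' j') (dyadicCube k j) := by
  obtain ⟨d, rfl⟩ := Int.le.dest hk
  have key : ∀ x ∈ dyadicCube (k + d) j', ∀ i, ⌊(2 : ℝ) ^ k * x i⌋ = j' i / ((2 ^ d : ℕ) : ℤ) := by
    intro x hx i
    rw [← mem_dyadicCube.1 hx i, ← Int.floor_div_natCast]
    congr 1
    rw [zpow_add₀ two_ne_zero, zpow_natCast]
    push_cast
    field_simp
  by_cases h : ∀ i, j' i / ((2 ^ d : ℕ) : ℤ) = j i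
  · left
    exact fun x hx => mem_dyadicCube.2 fun i => (key x hx i).trans (h i)
  · right
    rw [disjoint_left]
    exact fun x hx hx' => h fun i => (key x hx i).symm.trans (mem_dyadicCube.1 hx' i)

theorem dyadicCubes_nested (Q R : dyadicCubes n) :
    (Q : Set (Fin n → ℝ)) ⊆ R ∨ (R : Set (Fin n → ℝ)) ⊆ Q ∨
      Disjoint (Q : Set (Fin n → ℝ)) R := by
  obtain ⟨_, k, j, rfl⟩ := Q
  obtain ⟨_, k', j', rfl⟩ := R
  rcases le_total k k' with h | h
  · rcases dyadicCube_subset_or_disjoint h j j' with h | h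
    · exact Or.inr (Or.inl h)
    · exact Or.inr (Or.inr h.symm)
  · rcases dyadicCube_subset_or_disjoint h j' j with h | h
    · exact Or.inl h
    · exact Or.inr (Or.inr h)

instance countable_dyadicCubes : Countable (dyadicCubes n) := by
  have : dyadicCubes n = range fun kj : ℤ × (Fin n → ℤ) => dyadicCube kj.1 kj.2 := by
    ext Q
    constructor
    · rintro ⟨k, j, rfl⟩; exact ⟨(k, j), rfl⟩
    · rintro ⟨⟨k, j⟩, rfl⟩; exact ⟨k, j, rfl⟩
  rw [this]
  exact (countable_range _).to_subtype

theorem dyadicCubes_subset_cubes : dyadicCubes n ⊆ cubes n := by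
  rintro _ ⟨k, j, rfl⟩
  exact ⟨_, _, by positivity, rfl⟩

theorem measurableSet_of_mem_cubes {Q : Set (Fin n → ℝ)} (hQ : Q ∈ cubes n) :
    MeasurableSet Q := by
  obtain ⟨a, ℓ, -, rfl⟩ := hQ
  exact measurableSet_cube a ℓ

theorem volume_ne_zero_of_mem_cubes {Q : Set (Fin n → ℝ)} (hQ : Q ∈ cubes n) :
    volume Q ≠ 0 := by
  obtain ⟨a, ℓ, hℓ, rfl⟩ := hQ
  rw [volume_cube]
  exact pow_ne_zero _ (ENNReal.ofReal_pos.2 hℓ).ne'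

theorem volume_ne_top_of_mem_cubes {Q : Set (Fin n → ℝ)} (hQ : Q ∈ cubes n) :
    volume Q ≠ ∞ := by
  obtain ⟨a, ℓ, hℓ, rfl⟩ := hQ
  rw [volume_cube]
  exact ENNReal.pow_ne_top ENNReal.ofReal_ne_top

theorem lintegral_ne_top_of_mem_cubes {f : (Fin n → ℝ) → ℝ} (hf : LocallyIntegrable f volume)
    {Q : Set (Fin n → ℝ)} (hQ : Q ∈ cubes n) : ∫⁻ x in Q, ENNReal.ofReal (f x) ≠ ∞ := by
  obtain ⟨a, ℓ, hℓ, rfl⟩ := hQ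
  exact lintegral_cube_ne_top hf a ℓ

/-- One generation suffices: with dyadic side in [ℓ, 2ℓ), each coordinate of a point of the cube has
the index of the corner or the next one, which gives 2^n choices. -/
theorem exists_dyadic_cover {Q : Set (Fin n → ℝ)} (hQ : Q ∈ cubes n) :
    ∃ D : (Fin n → Fin 2) → dyadicCubes n, Q ⊆ ⋃ ε, (D ε : Set (Fin n → ℝ)) ∧
      ∀ ε, volume (D ε : Set (Fin n → ℝ)) ≤ 2 ^ n * volume Q ∧
        volume Q ≤ volume (D ε : Set (Fin n → ℝ)) := by
  obtain ⟨a, ℓ, hℓ, rfl⟩ := hQ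
  obtain ⟨l, hl, hl'⟩ := exists_mem_Ioc_zpow hℓ (one_lt_two : (1 : ℝ) < 2)
  obtain ⟨k, hk⟩ : ∃ k : ℤ, -k = l + 1 := ⟨-(l + 1), neg_neg _⟩
  rw [← hk] at hl'
  have hl2 : (2 : ℝ) ^ (-k) ≤ 2 * ℓ := by
    rw [hk, zpow_add_one₀ two_ne_zero]; linarith
  refine ⟨fun ε => ⟨dyadicCube k fun i => ⌊(2 : ℝ) ^ k * a i⌋ + ((ε i : ℕ) : ℤ), k, _, rfl⟩,
    fun x hx => ?_, fun ε => ⟨?_, ?_⟩⟩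
  · have h2 : (0 : ℝ) < 2 ^ k := by positivity
    have hkl : (2 : ℝ) ^ k * ℓ ≤ 1 := by
      rw [zpow_neg] at hl'
      calc (2 : ℝ) ^ k * ℓ ≤ 2 ^ k * (2 ^ k)⁻¹ := by gcongr
        _ = 1 := mul_inv_cancel₀ h2.ne'
    have hfl : ∀ i, ∃ e : Fin 2, ⌊(2 : ℝ) ^ k * x i⌋ = ⌊(2 : ℝ) ^ k * a i⌋ + ((e : ℕ) : ℤ) := by
      intro i
      have h1 : (2 : ℝ) ^ k * a i ≤ 2 ^ k * x i := by
        have := (hx i).1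
        gcongr
      have h3 : (2 : ℝ) ^ k * x i < 2 ^ k * a i + 1 := by
        have := mul_lt_mul_of_pos_left (hx i).2 h2
        linarith
      have h4 := Int.floor_mono h1
      have h5 := Int.floor_mono h3.le
      rw [Int.floor_add_one] at h5
      rcases (by omega : ⌊(2 : ℝ) ^ k * x i⌋ = ⌊(2 : ℝ) ^ k * a i⌋ ∨
        ⌊(2 : ℝ) ^ k * x i⌋ = ⌊(2 : ℝ) ^ k * a i⌋ + 1) with h | h
      · exact ⟨0, by simpa using h⟩
      · exact ⟨1, by simpa using h⟩
    choose ε hε using hfl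
    exact mem_iUnion.2 ⟨ε, mem_dyadicCube.2 hε⟩
  · change volume (cube _ _) ≤ _
    rw [volume_cube, volume_cube, ← mul_pow]
    gcongr
    rw [← ENNReal.ofReal_ofNat, ← ENNReal.ofReal_mul zero_le_two]
    exact ENNReal.ofReal_le_ofReal hl2
  · change _ ≤ volume (cube _ _)
    rw [volume_cube, volume_cube]
    gcongr

/-! ### Reduction of the Morrey norm to dyadic cubes -/

/-- It suffices to control the Morrey norm on dyadic cubes. -/
theorem morreyNorm_le_of_dyadic {ν : Measure (Fin n → ℝ)} {p p₀ : ℝ} (hp : 0 < p) (hp₀ : p ≤ p₀)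
    {g : (Fin n → ℝ) → ℝ≥0∞} {A : ℝ≥0∞}
    (h : ∀ Q : dyadicCubes n, volume (Q : Set (Fin n → ℝ)) ^ (1 / p₀ - 1 / p) *
      (∫⁻ x in (Q : Set (Fin n → ℝ)), g x ^ p ∂ν) ^ (1 / p) ≤ A) :
    morreyNorm ν p p₀ g ≤ ((2 ^ n) ^ (1 / p) * (2 ^ n) ^ (1 / p - 1 / p₀)) * A := by
  set s := 1 / p - 1 / p₀ with hs
  have hs0 : 0 ≤ s := sub_nonneg.2 (one_div_le_one_div_of_le hp hp₀)
  have hneg : 1 / p₀ - 1 / p = -s := by rw [hs]; ring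
  rw [hneg] at h
  refine iSup₂_le fun Q hQ => ?_
  rw [hneg]
  obtain ⟨D, hcov, hvol⟩ := exists_dyadic_cover hQ
  have hDc : ∀ ε, (D ε : Set (Fin n → ℝ)) ∈ cubes n := fun ε => dyadicCubes_subset_cubes (D ε).2
  have hV0 := volume_ne_zero_of_mem_cubes hQ
  have hVt := volume_ne_top_of_mem_cubes hQ
  have hX : ∀ ε, ∫⁻ x in (D ε : Set (Fin n → ℝ)), g x ^ p ∂ν ≤
      (A * (2 ^ n * volume Q) ^ s) ^ p := by
    intro ε
    have h1 := h (D ε)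
    have hd0 := volume_ne_zero_of_mem_cubes (hDc ε)
    have hdt := volume_ne_top_of_mem_cubes (hDc ε)
    have h2 : (∫⁻ x in (D ε : Set (Fin n → ℝ)), g x ^ p ∂ν) ^ (1 / p) ≤
        A * (2 ^ n * volume Q) ^ s := by
      calc _ = (volume (D ε : Set (Fin n → ℝ)) ^ (-s) *
            (∫⁻ x in (D ε : Set (Fin n → ℝ)), g x ^ p ∂ν) ^ (1 / p)) *
            volume (D ε : Set (Fin n → ℝ)) ^ s := by
            rw [mul_right_comm, ← ENNReal.rpow_add _ _ hd0 hdt, neg_add_cancel,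
              ENNReal.rpow_zero, one_mul]
        _ ≤ _ := by
            gcongr
            exact (hvol ε).1
    have h3 := ENNReal.rpow_le_rpow h2 hp.le
    rwa [← ENNReal.rpow_mul, one_div_mul_cancel hp.ne', ENNReal.rpow_one] at h3
  have hI : ∫⁻ x in Q, g x ^ p ∂ν ≤ 2 ^ n * (A * (2 ^ n * volume Q) ^ s) ^ p := by
    calc ∫⁻ x in Q, g x ^ p ∂ν
        ≤ ∫⁻ x in ⋃ ε, (D ε : Set (Fin n → ℝ)), g x ^ p ∂ν := lintegral_mono_set hcov
      _ ≤ ∑' ε, ∫⁻ x in (D ε : Set (Fin n → ℝ)), g x ^ p ∂ν := lintegral_iUnion_le _ _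
      _ ≤ ∑' _ : Fin n → Fin 2, (A * (2 ^ n * volume Q) ^ s) ^ p := ENNReal.tsum_le_tsum hX
      _ = _ := by
        rw [tsum_fintype, Finset.sum_const, Finset.card_univ]
        simp
  have hI' := ENNReal.rpow_le_rpow hI (one_div_nonneg.2 hp.le)
  rw [ENNReal.mul_rpow_of_nonneg _ _ (one_div_nonneg.2 hp.le), ← ENNReal.rpow_mul,
    mul_one_div_cancel hp.ne', ENNReal.rpow_one, ENNReal.mul_rpow_of_nonneg _ _ hs0] at hI'
  calc _ ≤ volume Q ^ (-s) * ((2 ^ n) ^ (1 / p) * (A * ((2 ^ n) ^ s * volume Q ^ s))) := by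
        gcongr
    _ = (volume Q ^ (-s) * volume Q ^ s) * ((2 ^ n) ^ (1 / p) * (2 ^ n) ^ s * A) := by ring
    _ = _ := by
        rw [← ENNReal.rpow_add _ _ hV0 hVt, neg_add_cancel, ENNReal.rpow_zero, one_mul]

/-! ### Quantitative A_∞ property -/

theorem one_add_mul_le_rpow_neg {s Λ : ℝ} (hs : 0 < s) {v : ℝ≥0∞}
    (hv : v ≤ ENNReal.ofReal (Real.exp (-Λ))) : ENNReal.ofReal (1 + s * Λ) ≤ v ^ (-s) := by
  have h1 : ENNReal.ofReal (Real.exp (-Λ)) ^ (-s) ≤ v ^ (-s) := by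
    rw [ENNReal.rpow_neg, ENNReal.rpow_neg]
    exact ENNReal.inv_le_inv.2 (ENNReal.rpow_le_rpow hv hs.le)
  refine le_trans ?_ h1
  rw [ENNReal.ofReal_rpow_of_pos (Real.exp_pos _), ← Real.exp_mul]
  refine ENNReal.ofReal_le_ofReal ?_
  have := Real.add_one_le_exp (-Λ * -s)
  linarith

/-- For positive finite v, v^{-s} ≥ 1 - s log v and log v ≤ v. The loss is linear in s, as needed
for bounds uniform in the Muckenhoupt exponent. -/
theorem one_le_rpow_neg_add {s : ℝ} (hs : 0 < s) (v : ℝ≥0∞) :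
    1 ≤ v ^ (-s) + ENNReal.ofReal s * v := by
  rcases eq_or_ne v ∞ with rfl | hv
  · simp [hs]
  rcases eq_or_ne v 0 with rfl | hv0
  · simp [hs]
  lift v to ℝ≥0 using hv
  have hv0 : 0 < (v : ℝ) := NNReal.coe_pos.2 (pos_iff_ne_zero.2 (by exact_mod_cast hv0))
  have h1 := one_add_mul_le_rpow_neg (v := v) (Λ := -Real.log v) hs
    (by rw [neg_neg, Real.exp_log hv0, ENNReal.ofReal_coe_nnreal])
  calc (1 : ℝ≥0∞) = ENNReal.ofReal 1 := ENNReal.ofReal_one.symm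
    _ ≤ ENNReal.ofReal (1 + s * -Real.log v + s * v) := by
        refine ENNReal.ofReal_le_ofReal ?_
        nlinarith [Real.log_le_sub_one_of_pos hv0]
    _ ≤ _ := ENNReal.ofReal_add_le
    _ ≤ _ := by
        rw [ENNReal.ofReal_mul hs.le, ENNReal.ofReal_coe_nnreal]
        gcongr

/-- The constant must not depend on q, so everything is kept to first order in s = 1/(q-1). For v =
w/⟨w⟩_Q, the A_q condition bounds the mean of v^{-s} by 1 + sL. Tiny values of v on E would each add
sΛ to v^{-s}, too much if they filled E. After cancellation a common factor s divides out. -/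
theorem measure_le_of_apConst_le {μ : (Fin n → ℝ) → ℝ} (hμ : IsWeight μ) {q : ℝ} (hq : 2 ≤ q)
    {L : ℝ≥0} (hL : apConst q μ ≤ (L : ℝ≥0∞) + 1) {Q E : Set (Fin n → ℝ)} (hQ : Q ∈ cubes n)
    (hE : MeasurableSet E) (hEQ : E ⊆ Q) (hvol : volume Q ≤ 2 * volume E) :
    weightMeasure μ Q ≤
      ENNReal.ofReal (2 * (L + 2) * Real.exp (2 * (L + 2))) * weightMeasure μ E := by
  -- Since |E| ≥ |Q|/2, this gives Λ|E| ≥ (L + 2)|Q|, one unit of |Q| more than the L + 1 appearing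
  -- on the other side after integration.
  set Λ : ℝ := 2 * (L + 2) with hΛ
  have hΛ0 : 0 < Λ := by positivity
  set s : ℝ := 1 / (q - 1) with hs
  have hs0 : 0 < s := one_div_pos.2 (by linarith)
  have hs1 : s ≤ 1 := by rw [hs, div_le_one (by linarith)]; linarith
  have hqs : q - 1 = 1 / s := by rw [hs, one_div_one_div]
  -- Chosen so that κ e^{-Λ} = Λ.
  set κ : ℝ≥0∞ := ENNReal.ofReal (Λ * Real.exp Λ) with hκ
  set w : (Fin n → ℝ) → ℝ≥0∞ := fun x => ENNReal.ofReal (μ x) with hw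
  have hwm : AEMeasurable w := hμ.locallyIntegrable.aestronglyMeasurable.aemeasurable.ennreal_ofReal
  have hQm := measurableSet_of_mem_cubes hQ
  have hV0 := volume_ne_zero_of_mem_cubes hQ
  have hVt := volume_ne_top_of_mem_cubes hQ
  have hWt : ∫⁻ x in Q, w x ≠ ∞ := lintegral_ne_top_of_mem_cubes hμ.locallyIntegrable hQ
  rw [weightMeasure, withDensity_apply _ hQm, withDensity_apply _ hE]
  change ∫⁻ x in Q, w x ≤ κ * ∫⁻ x in E, w x
  rcases eq_or_ne (∫⁻ x in Q, w x) 0 with h0 | h0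
  · rw [h0]; exact zero_le
  set t : ℝ≥0∞ := (∫⁻ x in Q, w x) / volume Q with ht
  have ht0 : t ≠ 0 := (ENNReal.div_pos h0 hVt).ne'
  have htt : t ≠ ∞ := ENNReal.div_ne_top hWt hV0
  -- The A_q inequality on `Q` raised to the power s; Bernoulli, valid because s ≤ 1, linearises (1
  -- + L)^s.
  have hap : (∫⁻ x in Q, w x ^ (-s)) * t ^ s ≤ ENNReal.ofReal (1 + s * L) * volume Q := by
    have h1 : t * ((∫⁻ x in Q, w x ^ (-s)) / volume Q) ^ (1 / s) ≤ L + 1 := by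
      refine le_trans ?_ hL
      rw [← hqs, ht, ← setLAverage_eq, ← setLAverage_eq]
      exact le_iSup₂ (f := fun Q (_ : Q ∈ cubes n) =>
        (⨍⁻ x in Q, ENNReal.ofReal (μ x) ∂volume) *
        (⨍⁻ x in Q, ENNReal.ofReal (μ x) ^ (-(1 / (q - 1))) ∂volume) ^ (q - 1)) Q hQ
    have h2 := ENNReal.rpow_le_rpow h1 hs0.le
    rw [ENNReal.mul_rpow_of_nonneg _ _ hs0.le, ← ENNReal.rpow_mul, one_div_mul_cancel hs0.ne',
      ENNReal.rpow_one] at h2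
    have h3 : ((L : ℝ≥0∞) + 1) ^ s ≤ ENNReal.ofReal (1 + s * L) := by
      have : (L : ℝ≥0∞) + 1 = ENNReal.ofReal (1 + L) := by
        rw [ENNReal.ofReal_add zero_le_one L.coe_nonneg, ENNReal.ofReal_one,
          ENNReal.ofReal_coe_nnreal, add_comm]
      rw [this, ENNReal.ofReal_rpow_of_pos (by positivity)]
      exact ENNReal.ofReal_le_ofReal
        (rpow_one_add_le_one_add_mul_self (by linarith [L.coe_nonneg]) hs0.le hs1)
    calc (∫⁻ x in Q, w x ^ (-s)) * t ^ s
        = t ^ s * ((∫⁻ x in Q, w x ^ (-s)) / volume Q) * volume Q := by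
          rw [mul_assoc, ENNReal.div_mul_cancel hV0 hVt, mul_comm]
      _ ≤ _ := mul_le_mul_left (h2.trans h3) _
  set σ := ENNReal.ofReal s with hσ
  have hσ0 : σ ≠ 0 := (ENNReal.ofReal_pos.2 hs0).ne'
  have hσt : σ ≠ ∞ := ENNReal.ofReal_ne_top
  -- On `E` with v = w/t: either v ≤ e^{-Λ} and v^{-s} alone supplies the extra sΛ, or κv ≥ Λ and
  -- the last term does.
  have hpt : ∀ x, 1 + E.indicator (fun _ => σ * ENNReal.ofReal Λ) x ≤
      (w x ^ (-s) * t ^ s + σ * (w x / t)) + E.indicator (fun x => σ * κ * (w x / t)) x := by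
    intro x
    have hv : w x ^ (-s) * t ^ s = (w x / t) ^ (-s) := by
      rw [ENNReal.rpow_neg, ENNReal.rpow_neg, ENNReal.div_rpow_of_nonneg (w x) t hs0.le,
        ENNReal.inv_div (Or.inl (ENNReal.rpow_ne_top_of_nonneg hs0.le htt))
        (Or.inl (ENNReal.rpow_pos (pos_iff_ne_zero.2 ht0) htt).ne'), mul_comm, div_eq_mul_inv]
    rw [hv]
    by_cases hx : x ∈ E
    · rw [indicator_of_mem hx, indicator_of_mem hx]
      rcases le_total (w x / t) (ENNReal.ofReal (Real.exp (-Λ))) with h | h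
      · refine le_trans ?_ (le_trans (one_add_mul_le_rpow_neg hs0 h)
          (le_self_add.trans le_self_add))
        rw [ENNReal.ofReal_add zero_le_one (by positivity), ENNReal.ofReal_one,
          ENNReal.ofReal_mul hs0.le]
      · refine add_le_add (one_le_rpow_neg_add hs0 _) ?_
        rw [mul_assoc]
        refine mul_le_mul_right ?_ _
        refine le_trans ?_ (mul_le_mul_right h _)
        rw [hκ, ← ENNReal.ofReal_mul (by positivity), mul_assoc, ← Real.exp_add]
        simp
    · rw [indicator_of_notMem hx, indicator_of_notMem hx, add_zero, add_zero]
      exact one_le_rpow_neg_add hs0 _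
  have hint := lintegral_mono (μ := volume.restrict Q) hpt
  have hdiv : ∀ A : Set (Fin n → ℝ), ∫⁻ x in A, w x / t = (∫⁻ x in A, w x) / t := by
    intro A
    simp_rw [div_eq_mul_inv]
    rw [lintegral_mul_const'' _ hwm.restrict]
  have htQ : (∫⁻ x in Q, w x) / t = volume Q := by
    rw [ht, ENNReal.div_eq_inv_mul, ENNReal.inv_div (Or.inl hVt) (Or.inl hV0),
      ENNReal.div_mul_cancel h0 hWt]
  rw [lintegral_add_left measurable_const, lintegral_indicator_const hE, setLIntegral_const,
    Measure.restrict_apply hE, inter_eq_left.2 hEQ, one_mul,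
    lintegral_add_right' _ (((hwm.div_const t).const_mul _).indicator hE).restrict,
    lintegral_add_right' _ ((hwm.div_const t).const_mul _).restrict,
    lintegral_indicator hE, Measure.restrict_restrict hE, inter_eq_left.2 hEQ,
    lintegral_const_mul'' _ (hwm.div_const t).restrict,
    lintegral_const_mul'' _ (hwm.div_const t).restrict, hdiv, hdiv, htQ,
    lintegral_mul_const'' _ (hwm.pow_const _).restrict] at hint
  set I := ∫⁻ x in E, w x with hI
  have hLam : σ * ((L : ℝ≥0∞) + 2) * volume Q ≤ σ * ENNReal.ofReal Λ * volume E := by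
    have : ENNReal.ofReal Λ = (L + 2) * 2 := by
      rw [hΛ, ENNReal.ofReal_mul zero_le_two, ENNReal.ofReal_add L.coe_nonneg zero_le_two,
        ENNReal.ofReal_coe_nnreal, ENNReal.ofReal_ofNat, mul_comm]
    rw [this, mul_assoc, mul_assoc, mul_assoc]
    gcongr
  have hfin : (volume Q + σ * (L + 1) * volume Q) ≠ ∞ := by finiteness
  have hmain : (volume Q + σ * (L + 1) * volume Q) + σ * volume Q ≤
      (volume Q + σ * (L + 1) * volume Q) + σ * (κ * (I / t)) := by
    calc _ = volume Q + σ * ((L : ℝ≥0∞) + 2) * volume Q := by ring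
      _ ≤ volume Q + σ * ENNReal.ofReal Λ * volume E := by gcongr
      _ ≤ _ := hint
      _ ≤ ENNReal.ofReal (1 + s * L) * volume Q + σ * volume Q + σ * κ * (I / t) := by gcongr
      _ = _ := by
        rw [ENNReal.ofReal_add zero_le_one (by positivity), ENNReal.ofReal_one,
          ENNReal.ofReal_mul hs0.le, ENNReal.ofReal_coe_nnreal]
        ring
  have h5 := (ENNReal.mul_le_mul_iff_right hσ0 hσt).1
    ((ENNReal.add_le_add_iff_left hfin).1 hmain)
  calc ∫⁻ x in Q, w x = t * volume Q := by rw [ht, ENNReal.div_mul_cancel hV0 hVt]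
    _ ≤ t * (κ * (I / t)) := by gcongr
    _ = κ * (t * (I / t)) := by ring
    _ ≤ κ * I := by gcongr; exact ENNReal.mul_div_le

/-- An `A_∞` weight charges large subsets of a cube, with a bound that depends only on the
`A_∞` constant. -/
theorem HasAInftyConst.measure_le {μ : (Fin n → ℝ) → ℝ} (hμ : IsWeight μ) {L : ℝ≥0}
    (hL : HasAInftyConst μ L) {Q E : Set (Fin n → ℝ)} (hQ : Q ∈ cubes n)
    (hE : MeasurableSet E) (hEQ : E ⊆ Q) (hvol : volume Q ≤ 2 * volume E) :
    weightMeasure μ Q ≤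
      ENNReal.ofReal (2 * (L + 2) * Real.exp (2 * (L + 2))) * weightMeasure μ E := by
  -- The unit of slack puts all large q below L + 1; q ≥ 2 ensures s ≤ 1.
  have hlt : (L : ℝ≥0∞) < L + 1 := ENNReal.lt_add_right ENNReal.coe_ne_top one_ne_zero
  obtain ⟨q, hq, hq2⟩ :=
    ((hL.eventually (gt_mem_nhds hlt)).and (eventually_ge_atTop (2 : ℝ))).exists
  exact measure_le_of_apConst_le hμ hq2 hq.le hQ hE hEQ hvol

/-! ### Averages, testing constants and the outer cubes -/

theorem rpow_finsetSum_of_nonneg {ι : Type*} (a : ℝ≥0∞) {s : Finset ι} {θ : ι → ℝ}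
    (h : ∀ i ∈ s, 0 ≤ θ i) : a ^ (∑ i ∈ s, θ i) = ∏ i ∈ s, a ^ θ i := by
  classical
  induction s using Finset.induction_on with
  | empty => simp
  | insert i s hi ih =>
    have hs : ∀ j ∈ s, 0 ≤ θ j := fun j hj => h j (Finset.mem_insert_of_mem hj)
    rw [Finset.sum_insert hi, Finset.prod_insert hi, ← ih hs,
      ENNReal.rpow_add_of_nonneg _ _ (h i (Finset.mem_insert_self _ _)) (Finset.sum_nonneg hs)]

theorem lintegral_div_le_rpow {α : Type*} [MeasurableSpace α] {ν : Measure α} {s : Set α}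
    (h0 : ν s ≠ 0) (ht : ν s ≠ ∞) {p : ℝ} (hp : 1 < p) {h : α → ℝ≥0∞} (hh : AEMeasurable h ν) :
    (∫⁻ x in s, h x ∂ν) / ν s ≤ ((∫⁻ x in s, h x ^ p ∂ν) / ν s) ^ (1 / p) := by
  have hp0 : 0 ≤ 1 / p := one_div_nonneg.2 (by linarith)
  refine ENNReal.div_le_of_le_mul ((lintegral_rpow_le_measure_mul hp hh).trans_eq ?_)
  rw [ENNReal.div_rpow_of_nonneg _ _ hp0, ENNReal.rpow_sub _ _ h0 ht, ENNReal.rpow_one]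
  simp only [div_eq_mul_inv]
  ring

theorem volume_ne_zero (R : dyadicCubes n) : volume (R : Set (Fin n → ℝ)) ≠ 0 :=
  volume_ne_zero_of_mem_cubes (dyadicCubes_subset_cubes R.2)

theorem volume_ne_top (R : dyadicCubes n) : volume (R : Set (Fin n → ℝ)) ≠ ∞ :=
  volume_ne_top_of_mem_cubes (dyadicCubes_subset_cubes R.2)

theorem measurableSet_dyadic (R : dyadicCubes n) : MeasurableSet (R : Set (Fin n → ℝ)) :=
  measurableSet_of_mem_cubes (dyadicCubes_subset_cubes R.2)

theorem IsWeight.aemeasurable {w : (Fin n → ℝ) → ℝ} (hw : IsWeight w) :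
    AEMeasurable (fun x => ENNReal.ofReal (w x)) :=
  hw.locallyIntegrable.aestronglyMeasurable.aemeasurable.ennreal_ofReal

theorem weightMeasure_dyadic (μ : (Fin n → ℝ) → ℝ) (R : dyadicCubes n) :
    weightMeasure μ (R : Set (Fin n → ℝ)) =
      ∫⁻ x in (R : Set (Fin n → ℝ)), ENNReal.ofReal (μ x) := by
  rw [weightMeasure, withDensity_apply _ (measurableSet_dyadic R)]

theorem weightMeasure_ne_top {μ : (Fin n → ℝ) → ℝ} (hμ : IsWeight μ) (R : dyadicCubes n) :
    weightMeasure μ (R : Set (Fin n → ℝ)) ≠ ∞ := by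
  rw [weightMeasure_dyadic]
  exact lintegral_ne_top_of_mem_cubes hμ.locallyIntegrable (dyadicCubes_subset_cubes R.2)

/-- Jensen for the exponent r. It lets the outer cubes be treated identically in both cases. -/
theorem testConst_le_bumpTestConst {p r : ℝ} (hp : 1 < p) (hr : 1 < r)
    (K : dyadicCubes n → ℝ≥0) {μ : (Fin n → ℝ) → ℝ} (hμ : IsWeight μ) :
    testConst m p K μ ≤ bumpTestConst m p r K μ := by
  refine iSup_mono fun Q => mul_le_mul_right ?_ _
  have h := ENNReal.rpow_le_rpow
    (lintegral_div_le_rpow (volume_ne_zero Q) (volume_ne_top Q) hr hμ.aemeasurable)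
    (one_div_nonneg.2 (by linarith : 0 ≤ p))
  rwa [← ENNReal.rpow_mul, one_div_mul_one_div] at h

/-- The contribution of the cubes that strictly contain `Q`. -/
theorem tsum_ssuperset_le {P : Fin m → ℝ} (hP : ∀ i, 1 < P i) {p₀ : ℝ} {B : ℝ≥0}
    {K : dyadicCubes n → ℝ≥0} (hK : ConditionD m p₀ B K) {f : Fin m → (Fin n → ℝ) → ℝ}
    (hf0 : ∀ i x, 0 ≤ f i x) (hf : ∀ i, LocallyIntegrable (f i) volume) (Q : dyadicCubes n) :
    ∑' R : {R : dyadicCubes n // (Q : Set (Fin n → ℝ)) ⊂ R},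
        (K R.1 : ℝ≥0∞) * ∏ i, ∫⁻ y in (R.1 : Set (Fin n → ℝ)), ENNReal.ofReal (f i y) ≤
      B * (K Q * volume (Q : Set (Fin n → ℝ)) ^ ((m : ℝ) - 1 / p₀)) *
        productMorreyNorm P p₀ f := by
  refine le_trans ?_ (mul_le_mul_left (hK Q) _)
  rw [← ENNReal.tsum_mul_right]
  refine ENNReal.tsum_le_tsum fun R => ?_
  rw [mul_assoc]
  refine mul_le_mul_right ?_ _
  set V := volume (R.1 : Set (Fin n → ℝ)) with hV
  have hV0 : V ≠ 0 := volume_ne_zero R.1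
  have hVt : V ≠ ∞ := volume_ne_top R.1
  calc ∏ i, ∫⁻ y in (R.1 : Set (Fin n → ℝ)), ENNReal.ofReal (f i y)
      ≤ ∏ i, (V * (⨍⁻ y in (R.1 : Set (Fin n → ℝ)), ENNReal.ofReal |f i y| ^ P i ∂volume) ^ (1 / P i)) := by
        refine Finset.prod_le_prod' fun i _ => ?_
        simp_rw [abs_of_nonneg (hf0 i _)]
        rw [setLAverage_eq, mul_comm]
        exact (ENNReal.div_le_iff hV0 hVt).1 (lintegral_div_le_rpow hV0 hVt (hP i)
          (hf i).aestronglyMeasurable.aemeasurable.ennreal_ofReal)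
    _ = V ^ ((m : ℝ) - 1 / p₀) * (V ^ (1 / p₀) *
          ∏ i, (⨍⁻ y in (R.1 : Set (Fin n → ℝ)), ENNReal.ofReal |f i y| ^ P i ∂volume) ^ (1 / P i)) := by
        rw [Finset.prod_mul_distrib, ← mul_assoc, ← ENNReal.rpow_add _ _ hV0 hVt, sub_add_cancel,
          ENNReal.rpow_natCast]
        simp
    _ ≤ _ := by
        refine mul_le_mul_right ?_ _
        exact le_iSup₂ (f := fun (Q : Set (Fin n → ℝ)) (_ : Q ∈ cubes n) => volume Q ^ (1 / p₀) *
          ∏ i, (⨍⁻ x in Q, ENNReal.ofReal |f i x| ^ P i ∂volume) ^ (1 / P i))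
          R.1 (dyadicCubes_subset_cubes R.1.2)

/-! ### Local strong type estimate inside a cube -/

/-- Replacing |R| by 2|E(R)| allows the Carleson embedding. The exponents p/p_i sum to one, so
Hölder separates the factors and each is embedded in its own L^{p_i}. -/
theorem sum_volume_mul_prod_average_le {P : Fin m → ℝ} (hP : ∀ i, 1 < P i) {p : ℝ} (hp : 1 < p)
    (hpP : 1 / p = ∑ i, 1 / P i) {F : Finset (dyadicCubes n)}
    {E : dyadicCubes n → Set (Fin n → ℝ)}
    (hE : ∀ R ∈ F, MeasurableSet (E R) ∧ E R ⊆ (R : Set (Fin n → ℝ)) ∧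
      volume (R : Set (Fin n → ℝ)) ≤ 2 * volume (E R))
    (hd : (F : Set (dyadicCubes n)).PairwiseDisjoint E) {Q : Set (Fin n → ℝ)}
    (hQ : ∀ R ∈ F, (R : Set (Fin n → ℝ)) ⊆ Q) {f : Fin m → (Fin n → ℝ) → ℝ≥0∞}
    (hf : ∀ i, AEMeasurable (f i)) :
    (∑ R ∈ F, volume (R : Set (Fin n → ℝ)) * (∏ i, (∫⁻ y in (R : Set (Fin n → ℝ)), f i y) /
        volume (R : Set (Fin n → ℝ))) ^ p) ^ (1 / p) ≤
      (2 ^ (1 / p) * ∏ i, ENNReal.ofReal (P i / (P i - 1))) *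
        ∏ i, (∫⁻ y in Q, f i y ^ P i) ^ (1 / P i) := by
  have hp0 : 0 < p := by linarith
  have hP0 : ∀ i, 0 < P i := fun i => by linarith [hP i]
  have hθ : ∑ i, p / P i = 1 := by
    calc ∑ i, p / P i = p * ∑ i, 1 / P i := by
          rw [Finset.mul_sum]; exact Finset.sum_congr rfl fun i _ => by ring
      _ = 1 := by rw [← hpP, mul_one_div_cancel hp0.ne']
  have hθ0 : ∀ i, 0 ≤ p / P i := fun i => (div_pos hp0 (hP0 i)).le
  set A : Fin m → dyadicCubes n → ℝ≥0∞ := fun i R =>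
    (∫⁻ y in (R : Set (Fin n → ℝ)), f i y) / volume (R : Set (Fin n → ℝ)) with hA
  have hEq : ∀ R, volume (E R) * (∏ i, A i R) ^ p =
      ∏ i, (volume (E R) * A i R ^ P i) ^ (p / P i) := by
    intro R
    calc volume (E R) * (∏ i, A i R) ^ p
        = (∏ i, volume (E R) ^ (p / P i)) * ∏ i, A i R ^ p := by
          rw [← rpow_finsetSum_of_nonneg _ fun i _ => hθ0 i, hθ, ENNReal.rpow_one,
            ENNReal.prod_rpow_of_nonneg hp0.le]
      _ = _ := by
          rw [← Finset.prod_mul_distrib]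
          refine Finset.prod_congr rfl fun i _ => ?_
          rw [ENNReal.mul_rpow_of_nonneg _ _ (hθ0 i), ← ENNReal.rpow_mul,
            mul_div_cancel₀ p (hP0 i).ne']
  have h1 : ∑ R ∈ F, volume (R : Set (Fin n → ℝ)) * (∏ i, A i R) ^ p ≤
      2 * ∏ i, (ENNReal.ofReal (P i / (P i - 1)) ^ P i * ∫⁻ y in Q, f i y ^ P i) ^ (p / P i) := by
    calc _ ≤ ∑ R ∈ F, 2 * (volume (E R) * (∏ i, A i R) ^ p) :=
          Finset.sum_le_sum fun R hR => by
            rw [← mul_assoc]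
            exact mul_le_mul_left (hE R hR).2.2 _
      _ = 2 * ∑ R ∈ F, ∏ i, (volume (E R) * A i R ^ P i) ^ (p / P i) := by
          rw [← Finset.mul_sum]
          simp_rw [hEq]
      _ ≤ 2 * ∏ i, (∑ R ∈ F, volume (E R) * A i R ^ P i) ^ (p / P i) := by
          gcongr
          exact sum_prod_rpow_le F Finset.univ (fun i R => volume (E R) * A i R ^ P i)
            (fun i _ => hθ0 i) hθ
      _ ≤ _ := by
          refine mul_le_mul_right (Finset.prod_le_prod' fun i _ =>
            ENNReal.rpow_le_rpow ?_ (hθ0 i)) _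
          exact carleson_embedding_subset (hP i) (fun R _ R' _ => dyadicCubes_nested R R')
            (fun R _ => measurableSet_dyadic R) (fun R _ => volume_ne_top R)
            (fun R hR => ⟨(hE R hR).1, (hE R hR).2.1⟩) hd (hf i) hQ
  have hip : 0 ≤ 1 / p := (one_div_pos.2 hp0).le
  refine (ENNReal.rpow_le_rpow h1 hip).trans_eq ?_
  rw [ENNReal.mul_rpow_of_nonneg _ _ hip, ← ENNReal.prod_rpow_of_nonneg hip, mul_assoc,
    ← Finset.prod_mul_distrib]
  congr 1
  refine Finset.prod_congr rfl fun i _ => ?_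
  have e1 : p / P i * (1 / p) = 1 / P i := by field_simp
  rw [← ENNReal.rpow_mul, e1, ENNReal.mul_rpow_of_nonneg _ _ (one_div_pos.2 (hP0 i)).le,
    ← ENNReal.rpow_mul, mul_one_div_cancel (hP0 i).ne', ENNReal.rpow_one]

/-- The weight enters only through `H`, which isolates what the two cases must supply: a sequence
`y` that carries all dependence on the dual function. -/
theorem lintegral_finset_sum_rpow_le {P : Fin m → ℝ} (hP : ∀ i, 1 < P i) {p q : ℝ}
    (hpq : p.HolderConjugate q)
    (hpP : 1 / p = ∑ i, 1 / P i) {F : Finset (dyadicCubes n)}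
    {E : dyadicCubes n → Set (Fin n → ℝ)}
    (hE : ∀ R ∈ F, MeasurableSet (E R) ∧ E R ⊆ (R : Set (Fin n → ℝ)) ∧
      volume (R : Set (Fin n → ℝ)) ≤ 2 * volume (E R))
    (hd : (F : Set (dyadicCubes n)).PairwiseDisjoint E) {Q : Set (Fin n → ℝ)}
    (hQ : ∀ R ∈ F, (R : Set (Fin n → ℝ)) ⊆ Q) {f : Fin m → (Fin n → ℝ) → ℝ≥0∞}
    (hf : ∀ i, AEMeasurable (f i))
    (hft : ∀ i (R : dyadicCubes n), ∫⁻ y in (R : Set (Fin n → ℝ)), f i y ≠ ∞)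
    {ν : Measure (Fin n → ℝ)} (hν : ∀ R : dyadicCubes n, ν (R : Set (Fin n → ℝ)) ≠ ∞)
    {K : dyadicCubes n → ℝ≥0} {A₀ C₂ : ℝ≥0∞}
    (H : ∀ g : (Fin n → ℝ) → ℝ≥0∞, Measurable g → ∃ y : dyadicCubes n → ℝ≥0∞,
      (∀ R ∈ F, (K R : ℝ≥0∞) * volume (R : Set (Fin n → ℝ)) ^ m *
        ∫⁻ x in (R : Set (Fin n → ℝ)), g x ∂ν ≤
          A₀ * (volume (R : Set (Fin n → ℝ)) ^ (1 / p) * y R)) ∧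
      (∑ R ∈ F, y R ^ q) ^ (1 / q) ≤ C₂ * (∫⁻ x, g x ^ q ∂ν) ^ (1 / q)) :
    (∫⁻ x, (∑ R ∈ F, ((K R : ℝ≥0∞) * ∏ i, ∫⁻ y in (R : Set (Fin n → ℝ)), f i y) *
        (R : Set (Fin n → ℝ)).indicator (fun _ => (1 : ℝ≥0∞)) x) ^ p ∂ν) ^ (1 / p) ≤
      (2 ^ (1 / p) * ∏ i, ENNReal.ofReal (P i / (P i - 1))) * C₂ * A₀ *
        ∏ i, (∫⁻ y in Q, f i y ^ P i) ^ (1 / P i) := by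
  refine lintegral_sum_indicator_rpow_le hpq (fun R _ => measurableSet_dyadic R)
    (fun R _ => hν R) (fun R _ => ?_) fun g hg => ?_
  · exact ENNReal.mul_ne_top ENNReal.coe_ne_top (ENNReal.prod_ne_top fun i _ => hft i R)
  obtain ⟨y, hy, hyq⟩ := H g hg
  set A : Fin m → dyadicCubes n → ℝ≥0∞ := fun i R =>
    (∫⁻ y in (R : Set (Fin n → ℝ)), f i y) / volume (R : Set (Fin n → ℝ)) with hA
  have hprod : ∀ R : dyadicCubes n, ∏ i, ∫⁻ y in (R : Set (Fin n → ℝ)), f i y =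
      volume (R : Set (Fin n → ℝ)) ^ m * ∏ i, A i R := by
    intro R
    calc _ = ∏ i, (volume (R : Set (Fin n → ℝ)) * A i R) :=
          Finset.prod_congr rfl fun i _ => by
            rw [hA, mul_comm, ENNReal.div_mul_cancel (volume_ne_zero R) (volume_ne_top R)]
      _ = _ := by rw [Finset.prod_mul_distrib]; simp
  have hx : ∀ R : dyadicCubes n, (volume (R : Set (Fin n → ℝ)) ^ (1 / p) * ∏ i, A i R) ^ p =
      volume (R : Set (Fin n → ℝ)) * (∏ i, A i R) ^ p := by
    intro R
    rw [ENNReal.mul_rpow_of_nonneg _ _ hpq.nonneg, ← ENNReal.rpow_mul,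
      one_div_mul_cancel hpq.ne_zero, ENNReal.rpow_one]
  calc _ ≤ ∑ R ∈ F, A₀ * ((volume (R : Set (Fin n → ℝ)) ^ (1 / p) * ∏ i, A i R) * y R) := by
        refine Finset.sum_le_sum fun R hR => ?_
        calc _ = (K R : ℝ≥0∞) * volume (R : Set (Fin n → ℝ)) ^ m *
              (∫⁻ x in (R : Set (Fin n → ℝ)), g x ∂ν) * ∏ i, A i R := by rw [hprod]; ring
          _ ≤ A₀ * (volume (R : Set (Fin n → ℝ)) ^ (1 / p) * y R) * ∏ i, A i R :=
              mul_le_mul_left (hy R hR) _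
          _ = _ := by ring
    _ ≤ A₀ * ((∑ R ∈ F, (volume (R : Set (Fin n → ℝ)) ^ (1 / p) * ∏ i, A i R) ^ p) ^ (1 / p) *
          (∑ R ∈ F, y R ^ q) ^ (1 / q)) := by
        rw [← Finset.mul_sum]
        exact mul_le_mul_right (ENNReal.inner_le_Lp_mul_Lq F _ _ hpq) _
    _ ≤ A₀ * (((2 ^ (1 / p) * ∏ i, ENNReal.ofReal (P i / (P i - 1))) *
          ∏ i, (∫⁻ y in Q, f i y ^ P i) ^ (1 / P i)) *
          (C₂ * (∫⁻ x, g x ^ q ∂ν) ^ (1 / q))) := by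
        simp_rw [hx]
        gcongr
        exact sum_volume_mul_prod_average_le hP hpq.lt hpP hE hd hQ hf
    _ = _ := by ring

/-- Passage from finite to infinite sums. -/
theorem lintegral_tsum_rpow_le_of_finset {α ι : Type*} [MeasurableSpace α] [Countable ι]
    {ν : Measure α} {u : ι → α → ℝ≥0∞} (hu : ∀ i, Measurable (u i)) {p : ℝ} (hp : 0 < p)
    {D : ℝ≥0∞} (h : ∀ F : Finset ι, (∫⁻ x, (∑ i ∈ F, u i x) ^ p ∂ν) ^ (1 / p) ≤ D) :
    (∫⁻ x, (∑' i, u i x) ^ p ∂ν) ^ (1 / p) ≤ D := by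
  have h' : ∫⁻ x, (∑' i, u i x) ^ p ∂ν ≤ D ^ p := by
    have : ∀ x, (∑' i, u i x) ^ p = ⨆ F : Finset ι, (∑ i ∈ F, u i x) ^ p := by
      intro x
      rw [ENNReal.tsum_eq_iSup_sum]
      exact (ENNReal.orderIsoRpow p hp).map_iSup _
    simp_rw [this]
    rw [lintegral_iSup_directed
      (fun F => ((Finset.measurable_fun_sum _ fun i _ => hu i).pow_const _).aemeasurable)]
    · refine iSup_le fun F => ?_
      have := ENNReal.rpow_le_rpow (h F) hp.le
      rwa [← ENNReal.rpow_mul, one_div_mul_cancel hp.ne', ENNReal.rpow_one] at this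
    · refine Monotone.directed_le fun F G hFG x => ENNReal.rpow_le_rpow ?_ hp.le
      exact Finset.sum_le_sum_of_subset hFG
  have := ENNReal.rpow_le_rpow h' (one_div_pos.2 hp).le
  rwa [← ENNReal.rpow_mul, mul_one_div_cancel hp.ne', ENNReal.rpow_one] at this

/-! ### Splitting at a dyadic cube and the Morrey bound -/

theorem sparseOperator_le_add (K : dyadicCubes n → ℝ≥0) (S : Set (dyadicCubes n))
    (f : Fin m → (Fin n → ℝ) → ℝ) (Q : dyadicCubes n) {x : Fin n → ℝ}
    (hx : x ∈ (Q : Set (Fin n → ℝ))) :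
    sparseOperator K S f x ≤
      (∑' R : {R : dyadicCubes n // (Q : Set (Fin n → ℝ)) ⊂ R},
        (K R.1 : ℝ≥0∞) * ∏ i, ∫⁻ y in (R.1 : Set (Fin n → ℝ)), ENNReal.ofReal (f i y)) +
      ∑' R : {R : dyadicCubes n // R ∈ S ∧ (R : Set (Fin n → ℝ)) ⊆ Q},
        ((K R.1 : ℝ≥0∞) * ∏ i, ∫⁻ y in (R.1 : Set (Fin n → ℝ)), ENNReal.ofReal (f i y)) *
          (R.1 : Set (Fin n → ℝ)).indicator (fun _ => (1 : ℝ≥0∞)) x := by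
  set a : dyadicCubes n → ℝ≥0∞ := fun R =>
    (K R : ℝ≥0∞) * ∏ i, ∫⁻ y in (R : Set (Fin n → ℝ)), ENNReal.ofReal (f i y)
  set b : dyadicCubes n → ℝ≥0∞ := fun R =>
    a R * (R : Set (Fin n → ℝ)).indicator (fun _ => (1 : ℝ≥0∞)) x with hb
  change ∑' R : S, b R.1 ≤ (∑' R : {R : dyadicCubes n | (Q : Set (Fin n → ℝ)) ⊂ R}, a R.1) +
    ∑' R : {R : dyadicCubes n | R ∈ S ∧ (R : Set (Fin n → ℝ)) ⊆ Q}, b R.1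
  rw [tsum_subtype S b, tsum_subtype _ a, tsum_subtype _ b, ← ENNReal.tsum_add]
  refine ENNReal.tsum_le_tsum fun R => ?_
  by_cases hRS : R ∈ S
  · rw [indicator_of_mem hRS]
    by_cases hxR : x ∈ (R : Set (Fin n → ℝ))
    · by_cases hRQ : (R : Set (Fin n → ℝ)) ⊆ Q
      · rw [indicator_of_mem (s := {R : dyadicCubes n | R ∈ S ∧ (R : Set (Fin n → ℝ)) ⊆ Q})
          ⟨hRS, hRQ⟩]
        exact le_add_self
      · have hQR : (Q : Set (Fin n → ℝ)) ⊂ R := by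
          rcases dyadicCubes_nested Q R with h | h | h
          · exact ⟨h, hRQ⟩
          · exact absurd h hRQ
          · exact absurd hxR (disjoint_left.1 h hx)
        rw [indicator_of_mem (s := {R : dyadicCubes n | (Q : Set (Fin n → ℝ)) ⊂ R}) hQR]
        simp [hb, hxR]
    · simp [hb, hxR]
  · rw [indicator_of_notMem hRS]
    exact zero_le

/-- The Morrey bound for the sparse operator, given a dual bound for single cubes. -/
theorem morreyNorm_sparseOperator_le {P : Fin m → ℝ} (hP : ∀ i, 1 < P i) {p q p₀ : ℝ}
    (hpq : p.HolderConjugate q) (hpP : 1 / p = ∑ i, 1 / P i) (hp₀ : p ≤ p₀) {B : ℝ≥0}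
    {μ : (Fin n → ℝ) → ℝ} (hμ : IsWeight μ) {K : dyadicCubes n → ℝ≥0}
    (hK : ConditionD m p₀ B K) {S : Set (dyadicCubes n)} {E : dyadicCubes n → Set (Fin n → ℝ)}
    (hE : ∀ R ∈ S, MeasurableSet (E R) ∧ E R ⊆ (R : Set (Fin n → ℝ)) ∧
      volume (R : Set (Fin n → ℝ)) ≤ 2 * volume (E R))
    (hd : S.PairwiseDisjoint E) {f : Fin m → (Fin n → ℝ) → ℝ}
    (hf0 : ∀ i x, 0 ≤ f i x) (hf : ∀ i, LocallyIntegrable (f i) volume)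
    {A₀ C₂ : ℝ≥0∞} (hA : testConst m p K μ ≤ A₀)
    (H : ∀ F : Finset (dyadicCubes n), (F : Set (dyadicCubes n)) ⊆ S →
      ∀ g : (Fin n → ℝ) → ℝ≥0∞, Measurable g → ∃ y : dyadicCubes n → ℝ≥0∞,
      (∀ R ∈ F, (K R : ℝ≥0∞) * volume (R : Set (Fin n → ℝ)) ^ m *
        ∫⁻ x in (R : Set (Fin n → ℝ)), g x ∂weightMeasure μ ≤
          A₀ * (volume (R : Set (Fin n → ℝ)) ^ (1 / p) * y R)) ∧
      (∑ R ∈ F, y R ^ q) ^ (1 / q) ≤ C₂ * (∫⁻ x, g x ^ q ∂weightMeasure μ) ^ (1 / q)) :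
    morreyNorm (weightMeasure μ) p p₀ (sparseOperator K S f) ≤
      ((2 ^ n) ^ (1 / p) * (2 ^ n) ^ (1 / p - 1 / p₀)) *
        (B + 2 ^ (1 / p) * (∏ i, ENNReal.ofReal (P i / (P i - 1))) * C₂) * A₀ *
        productMorreyNorm P p₀ f := by
  have hp1 : 1 ≤ p := hpq.lt.le
  have hip : 0 ≤ 1 / p := (one_div_pos.2 hpq.pos).le
  rw [mul_assoc, mul_assoc]
  refine morreyNorm_le_of_dyadic hpq.pos hp₀ fun Q => ?_
  set N := productMorreyNorm P p₀ f with hN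
  set C₁ := 2 ^ (1 / p) * ∏ i, ENNReal.ofReal (P i / (P i - 1)) with hC₁
  set ν := weightMeasure μ with hν
  set V := volume (Q : Set (Fin n → ℝ)) with hV
  have hV0 : V ≠ 0 := volume_ne_zero Q
  have hVt : V ≠ ∞ := volume_ne_top Q
  set U : ℝ≥0∞ := ∑' R : {R : dyadicCubes n // (Q : Set (Fin n → ℝ)) ⊂ R},
    (K R.1 : ℝ≥0∞) * ∏ i, ∫⁻ y in (R.1 : Set (Fin n → ℝ)), ENNReal.ofReal (f i y) with hU
  set ι := {R : dyadicCubes n // R ∈ S ∧ (R : Set (Fin n → ℝ)) ⊆ Q}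
  set u : ι → (Fin n → ℝ) → ℝ≥0∞ := fun R x =>
    ((K R.1 : ℝ≥0∞) * ∏ i, ∫⁻ y in (R.1 : Set (Fin n → ℝ)), ENNReal.ofReal (f i y)) *
      (R.1 : Set (Fin n → ℝ)).indicator (fun _ => (1 : ℝ≥0∞)) x with hu
  have hum : ∀ R, Measurable (u R) := fun R =>
    (measurable_const.indicator (measurableSet_dyadic R.1)).const_mul _
  have hlow : (∫⁻ x, (∑' R, u R x) ^ p ∂ν) ^ (1 / p) ≤ C₁ * C₂ * A₀ *
      ∏ i, (∫⁻ y in (Q : Set (Fin n → ℝ)), ENNReal.ofReal (f i y) ^ P i) ^ (1 / P i) := by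
    refine lintegral_tsum_rpow_le_of_finset hum hpq.pos fun F => ?_
    set G : Finset (dyadicCubes n) := F.map (Function.Embedding.subtype _) with hG
    have hGmem : ∀ R ∈ G, R ∈ S ∧ (R : Set (Fin n → ℝ)) ⊆ Q := by
      intro R hR
      obtain ⟨R', -, rfl⟩ := Finset.mem_map.1 hR
      exact R'.2
    have hGS : (G : Set (dyadicCubes n)) ⊆ S := fun R hR => (hGmem R hR).1
    have := lintegral_finset_sum_rpow_le hP hpq hpP (F := G) (fun R hR => hE R (hGS hR))
      (hd.subset hGS) (fun R hR => (hGmem R hR).2)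
      (f := fun i y => ENNReal.ofReal (f i y))
      (fun i => (hf i).aestronglyMeasurable.aemeasurable.ennreal_ofReal)
      (fun i R => lintegral_ne_top_of_mem_cubes (hf i) (dyadicCubes_subset_cubes R.2))
      (weightMeasure_ne_top hμ) (H G hGS)
    simp only [hG, Finset.sum_map] at this
    exact this
  have hsplit : (∫⁻ x in (Q : Set (Fin n → ℝ)), sparseOperator K S f x ^ p ∂ν) ^ (1 / p) ≤
      U * ν Q ^ (1 / p) + (∫⁻ x, (∑' R, u R x) ^ p ∂ν) ^ (1 / p) := by
    calc _ ≤ (∫⁻ x in (Q : Set (Fin n → ℝ)), ((fun _ => U) + fun x => ∑' R, u R x : (Fin n → ℝ) → ℝ≥0∞) x ^ p ∂ν) ^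
          (1 / p) := by
          refine ENNReal.rpow_le_rpow (setLIntegral_mono' (measurableSet_dyadic Q)
            fun x hx => ENNReal.rpow_le_rpow ?_ hpq.nonneg) hip
          exact sparseOperator_le_add K S f Q hx
      _ ≤ _ := ENNReal.lintegral_Lp_add_le aemeasurable_const
          (Measurable.tsum hum).aemeasurable hp1
      _ ≤ _ := by
          refine add_le_add (le_of_eq ?_)
            (ENNReal.rpow_le_rpow (setLIntegral_le_lintegral _ _) hip)
          rw [setLIntegral_const, ENNReal.mul_rpow_of_nonneg _ _ hip, ← ENNReal.rpow_mul,
            mul_one_div_cancel hpq.ne_zero, ENNReal.rpow_one]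
  -- The powers of |Q| combine to m - 1/p, independent of p₀, which is exactly the normalisation of
  -- the testing constant at `Q`.
  have hup : V ^ (1 / p₀ - 1 / p) * (U * ν Q ^ (1 / p)) ≤ B * (A₀ * N) := by
    calc _ ≤ V ^ (1 / p₀ - 1 / p) * (B * (K Q * V ^ ((m : ℝ) - 1 / p₀)) * N * ν Q ^ (1 / p)) := by
          gcongr
          exact tsum_ssuperset_le hP hK hf0 hf Q
      _ = B * ((K Q * (V ^ (1 / p₀ - 1 / p) * V ^ ((m : ℝ) - 1 / p₀)) * ν Q ^ (1 / p)) * N) := by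
          ring
      _ = B * ((K Q * V ^ m * (ν Q / V) ^ (1 / p)) * N) := by
          rw [← ENNReal.rpow_add _ _ hV0 hVt, ENNReal.div_rpow_of_nonneg _ _ hip,
            show 1 / p₀ - 1 / p + ((m : ℝ) - 1 / p₀) = m - 1 / p by ring,
            ENNReal.rpow_sub _ _ hV0 hVt, ENNReal.rpow_natCast]
          simp only [div_eq_mul_inv]
          ring
      _ ≤ B * (A₀ * N) := by
          gcongr
          refine le_trans ?_ hA
          rw [hν, weightMeasure_dyadic]
          exact le_iSup (fun Q : dyadicCubes n => (K Q : ℝ≥0∞) *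
            volume (Q : Set (Fin n → ℝ)) ^ m * ((∫⁻ x in (Q : Set (Fin n → ℝ)),
              ENNReal.ofReal (μ x)) / volume (Q : Set (Fin n → ℝ))) ^ (1 / p)) Q
  -- As 1/p is the sum of the 1/p_i, the factor |Q|^{-1/p} distributes over the product and turns
  -- integrals into averages.
  have hprod : V ^ (1 / p₀ - 1 / p) *
      ∏ i, (∫⁻ y in (Q : Set (Fin n → ℝ)), ENNReal.ofReal (f i y) ^ P i) ^ (1 / P i) ≤ N := by
    have hPi : ∀ i, 0 ≤ 1 / P i := fun i => one_div_nonneg.2 (by linarith [hP i])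
    refine le_trans (le_of_eq ?_) (le_iSup₂ (f := fun (Q : Set (Fin n → ℝ)) (_ : Q ∈ cubes n) =>
      volume Q ^ (1 / p₀) * ∏ i, (⨍⁻ x in Q, ENNReal.ofReal |f i x| ^ P i ∂volume) ^ (1 / P i))
      Q (dyadicCubes_subset_cubes Q.2))
    simp_rw [abs_of_nonneg (hf0 _ _), setLAverage_eq]
    rw [← hV, ENNReal.rpow_sub _ _ hV0 hVt, div_eq_mul_inv, mul_assoc]
    congr 1
    simp_rw [ENNReal.div_rpow_of_nonneg _ _ (hPi _)]
    rw [Finset.prod_congr rfl fun i _ => div_eq_mul_inv _ _, Finset.prod_mul_distrib, mul_comm, hpP, rpow_finsetSum_of_nonneg _ fun i _ => hPi i,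
      ENNReal.prod_inv_distrib]
    exact fun i _ j _ _ => Or.inl (ENNReal.rpow_pos (pos_iff_ne_zero.2 hV0) hVt).ne'
  calc _ ≤ V ^ (1 / p₀ - 1 / p) * (U * ν Q ^ (1 / p) + C₁ * C₂ * A₀ *
        ∏ i, (∫⁻ y in (Q : Set (Fin n → ℝ)), ENNReal.ofReal (f i y) ^ P i) ^ (1 / P i)) := by
        gcongr
        exact hsplit.trans (by gcongr)
    _ = V ^ (1 / p₀ - 1 / p) * (U * ν Q ^ (1 / p)) + C₁ * C₂ * A₀ * (V ^ (1 / p₀ - 1 / p) *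
        ∏ i, (∫⁻ y in (Q : Set (Fin n → ℝ)), ENNReal.ofReal (f i y) ^ P i) ^ (1 / P i)) := by
        ring
    _ ≤ B * (A₀ * N) + C₁ * C₂ * A₀ * N := by gcongr
    _ = _ := by ring

/-- The dual bound for single cubes in the case of a weight that charges large subsets. -/
theorem exists_dual_bound_of_measure_le {p q : ℝ} (hpq : p.HolderConjugate q)
    {μ : (Fin n → ℝ) → ℝ} (hμ : IsWeight μ) {κ : ℝ≥0∞} (K : dyadicCubes n → ℝ≥0)
    {F : Finset (dyadicCubes n)} {E : dyadicCubes n → Set (Fin n → ℝ)}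
    (hE : ∀ R ∈ F, MeasurableSet (E R) ∧ E R ⊆ (R : Set (Fin n → ℝ)))
    (hκ : ∀ R ∈ F, weightMeasure μ (R : Set (Fin n → ℝ)) ≤ κ * weightMeasure μ (E R))
    (hd : (F : Set (dyadicCubes n)).PairwiseDisjoint E) {g : (Fin n → ℝ) → ℝ≥0∞}
    (hg : Measurable g) :
    ∃ y : dyadicCubes n → ℝ≥0∞,
      (∀ R ∈ F, (K R : ℝ≥0∞) * volume (R : Set (Fin n → ℝ)) ^ m *
        ∫⁻ x in (R : Set (Fin n → ℝ)), g x ∂weightMeasure μ ≤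
          testConst m p K μ * (volume (R : Set (Fin n → ℝ)) ^ (1 / p) * y R)) ∧
      (∑ R ∈ F, y R ^ q) ^ (1 / q) ≤ (κ * ENNReal.ofReal (q / (q - 1)) ^ q) ^ (1 / q) *
        (∫⁻ x, g x ^ q ∂weightMeasure μ) ^ (1 / q) := by
  set ν := weightMeasure μ with hν
  have hip : 0 ≤ 1 / p := (one_div_pos.2 hpq.pos).le
  have hiq : 0 ≤ 1 / q := (one_div_pos.2 hpq.symm.pos).le
  have hνt : ∀ R : dyadicCubes n, ν (R : Set (Fin n → ℝ)) ≠ ∞ := weightMeasure_ne_top hμ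
  refine ⟨fun R => ν (R : Set (Fin n → ℝ)) ^ (1 / q) *
    ((∫⁻ x in (R : Set (Fin n → ℝ)), g x ∂ν) / ν (R : Set (Fin n → ℝ))), fun R _ => ?_, ?_⟩
  · set V := volume (R : Set (Fin n → ℝ)) with hV
    set W := ν (R : Set (Fin n → ℝ)) with hW
    set I := ∫⁻ x in (R : Set (Fin n → ℝ)), g x ∂ν with hI
    have hV0 : V ≠ 0 := volume_ne_zero R
    have hVt : V ≠ ∞ := volume_ne_top R
    rcases eq_or_ne W 0 with h0 | h0
    · rw [hI, Measure.restrict_eq_zero.2 h0, lintegral_zero_measure, mul_zero]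
      exact zero_le
    have hA : (K R : ℝ≥0∞) * V ^ m * (W / V) ^ (1 / p) ≤ testConst m p K μ := by
      rw [hW, hν, weightMeasure_dyadic]
      exact le_iSup (fun Q : dyadicCubes n => (K Q : ℝ≥0∞) *
        volume (Q : Set (Fin n → ℝ)) ^ m * ((∫⁻ x in (Q : Set (Fin n → ℝ)),
          ENNReal.ofReal (μ x)) / volume (Q : Set (Fin n → ℝ))) ^ (1 / p)) R
    refine le_trans (le_of_eq ?_) (mul_le_mul_left hA _)
    have h1 : (W / V) ^ (1 / p) * V ^ (1 / p) = W ^ (1 / p) := by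
      rw [← ENNReal.mul_rpow_of_nonneg _ _ hip, ENNReal.div_mul_cancel hV0 hVt]
    have h2 : W ^ (1 / p) * W ^ (1 / q) = W := by
      rw [← ENNReal.rpow_add _ _ h0 (hνt R), one_div, one_div, hpq.inv_add_inv_eq_one,
        ENNReal.rpow_one]
    calc (K R : ℝ≥0∞) * V ^ m * I
        = (K R : ℝ≥0∞) * V ^ m * ((((W / V) ^ (1 / p) * V ^ (1 / p)) * W ^ (1 / q)) *
            (I / W)) := by
          rw [h1, h2, mul_comm W, ENNReal.div_mul_cancel h0 (hνt R)]
      _ = _ := by ring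
  · rw [← ENNReal.mul_rpow_of_nonneg _ _ hiq]
    refine ENNReal.rpow_le_rpow ?_ hiq
    rw [mul_assoc]
    refine le_trans (Finset.sum_le_sum fun R hR => ?_) ((Finset.mul_sum _ _ _).ge.trans
      (mul_le_mul_right (carleson_embedding (ν := ν) hpq.symm.lt
        (fun R _ R' _ => dyadicCubes_nested R R') (fun R _ => measurableSet_dyadic R)
        (fun R _ => hνt R) hE hd hg.aemeasurable) κ))
    rw [ENNReal.mul_rpow_of_nonneg _ _ hpq.symm.nonneg, ← ENNReal.rpow_mul,
      one_div_mul_cancel hpq.symm.ne_zero, ENNReal.rpow_one, ← mul_assoc]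
    exact mul_le_mul_left (hκ R hR) _

/-- The dual bound for single cubes in the case of a power bump. -/
theorem exists_dual_bound_of_bump {p q r : ℝ} (hpq : p.HolderConjugate q) (hr : 1 < r)
    {μ : (Fin n → ℝ) → ℝ} (hμ : IsWeight μ) (K : dyadicCubes n → ℝ≥0) {u : ℝ}
    (hu : u = q / (r * p / (r * p - 1)))
    {F : Finset (dyadicCubes n)} {E : dyadicCubes n → Set (Fin n → ℝ)}
    (hE : ∀ R ∈ F, MeasurableSet (E R) ∧ E R ⊆ (R : Set (Fin n → ℝ)) ∧
      volume (R : Set (Fin n → ℝ)) ≤ 2 * volume (E R))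
    (hd : (F : Set (dyadicCubes n)).PairwiseDisjoint E) {g : (Fin n → ℝ) → ℝ≥0∞}
    (hg : Measurable g) :
    ∃ y : dyadicCubes n → ℝ≥0∞,
      (∀ R ∈ F, (K R : ℝ≥0∞) * volume (R : Set (Fin n → ℝ)) ^ m *
        ∫⁻ x in (R : Set (Fin n → ℝ)), g x ∂weightMeasure μ ≤
          bumpTestConst m p r K μ * (volume (R : Set (Fin n → ℝ)) ^ (1 / p) * y R)) ∧
      (∑ R ∈ F, y R ^ q) ^ (1 / q) ≤ (2 * ENNReal.ofReal (u / (u - 1)) ^ u) ^ (1 / q) *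
        (∫⁻ x, g x ^ q ∂weightMeasure μ) ^ (1 / q) := by
  have hp1 := hpq.lt
  have hrp : p < r * p := by nlinarith
  have hst : (r * p).HolderConjugate (r * p / (r * p - 1)) :=
    Real.HolderConjugate.conjExponent (by linarith)
  set t := r * p / (r * p - 1) with ht
  -- Here the strict bump r > 1 is used: rp > p forces t = (rp)' < q.
  have hu1 : 1 < u := by
    have hq := hpq.inv_add_inv_eq_one
    have ht' := hst.inv_add_inv_eq_one
    have h1 : (r * p)⁻¹ < p⁻¹ := inv_strictAnti₀ hpq.pos hrp
    have h2 : q⁻¹ < t⁻¹ := by linarith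
    rw [hu, one_lt_div hst.symm.pos]
    exact (inv_lt_inv₀ hpq.symm.pos hst.symm.pos).1 h2
  have htu : t * u = q := by rw [hu, mul_div_cancel₀ q hst.symm.ne_zero]
  have hip : 0 ≤ 1 / p := (one_div_pos.2 hpq.pos).le
  have hiq : 0 ≤ 1 / q := (one_div_pos.2 hpq.symm.pos).le
  set w : (Fin n → ℝ) → ℝ≥0∞ := fun x => ENNReal.ofReal (μ x) with hw
  have hwm : AEMeasurable w := hμ.aemeasurable
  set h : (Fin n → ℝ) → ℝ≥0∞ := fun x => g x * w x ^ (1 / q) with hh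
  have hhm : AEMeasurable h := hg.aemeasurable.mul (hwm.pow_const _)
  -- Writing μ = μ^{1/q} μ^{1/p} puts the first factor into h, whose L^q(dx) norm is that of g in
  -- L^q(μ), and leaves the second for the bump.
  have hdens : ∀ (R : dyadicCubes n), ∫⁻ x in (R : Set (Fin n → ℝ)), g x ∂weightMeasure μ =
      ∫⁻ x in (R : Set (Fin n → ℝ)), (h * fun x => w x ^ (1 / p)) x := by
    intro R
    rw [weightMeasure, restrict_withDensity (measurableSet_dyadic R),
      lintegral_withDensity_eq_lintegral_mul₀ hwm.restrict hg.aemeasurable]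
    refine lintegral_congr fun x => ?_
    have : w x = w x ^ (1 / q) * w x ^ (1 / p) := by
      rw [← ENNReal.rpow_add_of_nonneg _ _ hiq hip, one_div, one_div,
        hpq.symm.inv_add_inv_eq_one, ENNReal.rpow_one]
    change w x * g x = g x * w x ^ (1 / q) * w x ^ (1 / p)
    rw [mul_assoc, ← this, mul_comm]
  have hgq : ∫⁻ x, g x ^ q ∂weightMeasure μ = ∫⁻ x, (h x ^ t) ^ u := by
    rw [weightMeasure, lintegral_withDensity_eq_lintegral_mul₀ hwm (hg.pow_const _).aemeasurable]
    refine lintegral_congr fun x => ?_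
    change w x * g x ^ q = ((g x * w x ^ (1 / q)) ^ t) ^ u
    rw [← ENNReal.rpow_mul, htu, ENNReal.mul_rpow_of_nonneg _ _ hpq.symm.nonneg,
      ← ENNReal.rpow_mul, one_div_mul_cancel hpq.symm.ne_zero, ENNReal.rpow_one, mul_comm]
  refine ⟨fun R => volume (R : Set (Fin n → ℝ)) ^ (1 / q) *
    ((∫⁻ x in (R : Set (Fin n → ℝ)), h x ^ t) / volume (R : Set (Fin n → ℝ))) ^ (1 / t),
    fun R _ => ?_, ?_⟩
  · rw [hdens]
    set V := volume (R : Set (Fin n → ℝ)) with hV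
    set I := ∫⁻ x in (R : Set (Fin n → ℝ)), h x ^ t with hI
    set W := ∫⁻ x in (R : Set (Fin n → ℝ)), w x ^ r with hW
    have hV0 : V ≠ 0 := volume_ne_zero R
    have hVt : V ≠ ∞ := volume_ne_top R
    have hA : (K R : ℝ≥0∞) * V ^ m * (W / V) ^ (1 / (r * p)) ≤ bumpTestConst m p r K μ :=
      le_iSup (fun Q : dyadicCubes n => (K Q : ℝ≥0∞) *
        volume (Q : Set (Fin n → ℝ)) ^ m * ((∫⁻ x in (Q : Set (Fin n → ℝ)),
          ENNReal.ofReal (μ x) ^ r) / volume (Q : Set (Fin n → ℝ))) ^ (1 / (r * p))) R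
    refine le_trans ?_ (mul_le_mul_left hA _)
    have hol := ENNReal.lintegral_mul_le_Lp_mul_Lq
      (volume.restrict (R : Set (Fin n → ℝ))) hst.symm hhm.restrict
      (hwm.pow_const (1 / p)).restrict
    have e1 : 1 / p * (r * p) = r := by field_simp [hpq.ne_zero]
    simp_rw [← ENNReal.rpow_mul, e1] at hol
    have h1 : V ^ (1 / (r * p)) * V ^ (1 / t) = V ^ (1 / p) * V ^ (1 / q) := by
      rw [← ENNReal.rpow_add _ _ hV0 hVt, ← ENNReal.rpow_add _ _ hV0 hVt, one_div, one_div,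
        one_div, one_div, hpq.inv_add_inv_eq_one, hst.inv_add_inv_eq_one]
    have h2 : ∀ (X : ℝ≥0∞) {a : ℝ}, 0 ≤ a → X ^ a = (X / V) ^ a * V ^ a := by
      intro X a ha
      rw [← ENNReal.mul_rpow_of_nonneg _ _ ha, ENNReal.div_mul_cancel hV0 hVt]
    calc _ ≤ (K R : ℝ≥0∞) * V ^ m * (I ^ (1 / t) * W ^ (1 / (r * p))) := mul_le_mul_right hol _
      _ = (K R : ℝ≥0∞) * V ^ m * ((W / V) ^ (1 / (r * p)) * (I / V) ^ (1 / t) *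
            (V ^ (1 / (r * p)) * V ^ (1 / t))) := by
          rw [h2 I (one_div_pos.2 hst.symm.pos).le, h2 W (one_div_pos.2 hst.pos).le]
          ring
      _ = _ := by
          rw [h1]
          ring
  · rw [hgq, ← ENNReal.mul_rpow_of_nonneg _ _ hiq]
    refine ENNReal.rpow_le_rpow ?_ hiq
    rw [mul_assoc]
    refine le_trans (Finset.sum_le_sum fun R hR => ?_) ((Finset.mul_sum _ _ _).ge.trans
      (mul_le_mul_right (carleson_embedding (ν := volume) hu1
        (fun R _ R' _ => dyadicCubes_nested R R') (fun R _ => measurableSet_dyadic R)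
        (fun R _ => volume_ne_top R) (fun R hR => ⟨(hE R hR).1, (hE R hR).2.1⟩) hd
        (hhm.pow_const t)) 2))
    have e2 : 1 / t * q = u := by rw [hu]; ring
    rw [ENNReal.mul_rpow_of_nonneg _ _ hpq.symm.nonneg, ← ENNReal.rpow_mul,
      one_div_mul_cancel hpq.symm.ne_zero, ENNReal.rpow_one, ← ENNReal.rpow_mul, e2, ← mul_assoc]
    exact mul_le_mul_left (hE R hR).2.2 _

/-! ### Finiteness of the constant and conclusion -/

theorem morrey_constant_ne_top {P : Fin m → ℝ} {p p₀ : ℝ} (hp : 0 < p) (hp₀ : p ≤ p₀) (B : ℝ≥0)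
    {C₂ : ℝ≥0∞} (hC₂ : C₂ ≠ ∞) :
    ((2 ^ n) ^ (1 / p) * (2 ^ n) ^ (1 / p - 1 / p₀)) *
      (B + 2 ^ (1 / p) * (∏ i, ENNReal.ofReal (P i / (P i - 1))) * C₂) ≠ ∞ := by
  have hip : 0 ≤ 1 / p := (one_div_pos.2 hp).le
  have hs : 0 ≤ 1 / p - 1 / p₀ := sub_nonneg.2 (one_div_le_one_div_of_le hp hp₀)
  have h2 : (2 : ℝ≥0∞) ^ n ≠ ∞ := ENNReal.pow_ne_top ENNReal.ofNat_ne_top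
  refine ENNReal.mul_ne_top (ENNReal.mul_ne_top (ENNReal.rpow_ne_top_of_nonneg hip h2)
    (ENNReal.rpow_ne_top_of_nonneg hs h2)) (ENNReal.add_ne_top.2 ⟨ENNReal.coe_ne_top, ?_⟩)
  exact ENNReal.mul_ne_top (ENNReal.mul_ne_top
    (ENNReal.rpow_ne_top_of_nonneg hip ENNReal.ofNat_ne_top)
    (ENNReal.prod_ne_top fun i _ => ENNReal.ofReal_ne_top)) hC₂

end ProductMorrey

theorem theorem2p1 (n m : ℕ) (hn : 0 < n) (P : Fin m → ℝ) (hP : ∀ i, 1 < P i)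
    (p p₀ : ℝ) (hpP : 1 / p = ∑ i, 1 / P i) (hp : 1 < p) (hp₀ : p ≤ p₀) (B : ℝ≥0) :
    (∀ L : ℝ≥0, ∃ C : ℝ≥0,
      ∀ μ : (Fin n → ℝ) → ℝ, ProductMorrey.IsWeight μ → ProductMorrey.HasAInftyConst μ L →
      ∀ K : ProductMorrey.dyadicCubes n → ℝ≥0, ProductMorrey.ConditionD m p₀ B K →
        ProductMorrey.testConst m p K μ < ∞ →
      ∀ S : Set (ProductMorrey.dyadicCubes n), ProductMorrey.IsSparse S →
      ∀ f : Fin m → (Fin n → ℝ) → ℝ, (∀ i x, 0 ≤ f i x) →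
        (∀ i, LocallyIntegrable (f i) volume) →
        ProductMorrey.morreyNorm (ProductMorrey.weightMeasure μ) p p₀
            (ProductMorrey.sparseOperator K S f) ≤
          C * ProductMorrey.testConst m p K μ * ProductMorrey.productMorreyNorm P p₀ f) ∧
    (∀ r : ℝ, 1 < r → ∃ C : ℝ≥0,
      ∀ μ : (Fin n → ℝ) → ℝ, ProductMorrey.IsWeight μ →
      ∀ K : ProductMorrey.dyadicCubes n → ℝ≥0, ProductMorrey.ConditionD m p₀ B K →
        ProductMorrey.bumpTestConst m p r K μ < ∞ →
      ∀ S : Set (ProductMorrey.dyadicCubes n), ProductMorrey.IsSparse S →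
      ∀ f : Fin m → (Fin n → ℝ) → ℝ, (∀ i x, 0 ≤ f i x) →
        (∀ i, LocallyIntegrable (f i) volume) →
        ProductMorrey.morreyNorm (ProductMorrey.weightMeasure μ) p p₀
            (ProductMorrey.sparseOperator K S f) ≤
          C * ProductMorrey.bumpTestConst m p r K μ * ProductMorrey.productMorreyNorm P p₀ f) := by
  have hpq : p.HolderConjugate (p / (p - 1)) := Real.HolderConjugate.conjExponent hp
  set q := p / (p - 1)
  have hq : 0 ≤ q := hpq.symm.nonneg
  have hiq : 0 ≤ 1 / q := one_div_nonneg.2 hq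
  constructor
  · intro L
    set κ : ℝ≥0∞ := ENNReal.ofReal (2 * (L + 2) * Real.exp (2 * (L + 2)))
    set C₂ : ℝ≥0∞ := (κ * ENNReal.ofReal (q / (q - 1)) ^ q) ^ (1 / q)
    have hC₂t : C₂ ≠ ∞ := ENNReal.rpow_ne_top_of_nonneg hiq (ENNReal.mul_ne_top
      ENNReal.ofReal_ne_top (ENNReal.rpow_ne_top_of_nonneg hq ENNReal.ofReal_ne_top))
    have hC := ProductMorrey.morrey_constant_ne_top (n := n) (P := P) hpq.pos hp₀ B hC₂t
    obtain ⟨C, hCeq⟩ : ∃ C : ℝ≥0, (C : ℝ≥0∞) = _ := ⟨_, ENNReal.coe_toNNReal hC⟩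
    refine ⟨C, fun μ hμ hμL K hK _ S hS f hf0 hf => ?_⟩
    rw [hCeq]
    obtain ⟨E, hE, hd⟩ := hS
    refine ProductMorrey.morreyNorm_sparseOperator_le hP hpq hpP hp₀ hμ hK hE hd hf0 hf le_rfl
      fun F hF g hg => ?_
    exact ProductMorrey.exists_dual_bound_of_measure_le hpq hμ K
      (fun R hR => ⟨(hE R (hF hR)).1, (hE R (hF hR)).2.1⟩)
      (fun R hR => hμL.measure_le hμ (ProductMorrey.dyadicCubes_subset_cubes R.2)
        (hE R (hF hR)).1 (hE R (hF hR)).2.1 (hE R (hF hR)).2.2) (hd.subset hF) hg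
  · intro r hr
    obtain ⟨u, hu⟩ : ∃ u : ℝ, u = q / (r * p / (r * p - 1)) := ⟨_, rfl⟩
    have hu0 : 0 ≤ u := by
      have : 0 ≤ r * p - 1 := by nlinarith
      rw [hu]
      exact div_nonneg hq (div_nonneg (by positivity) this)
    set C₂ : ℝ≥0∞ := (2 * ENNReal.ofReal (u / (u - 1)) ^ u) ^ (1 / q)
    have hC₂t : C₂ ≠ ∞ := ENNReal.rpow_ne_top_of_nonneg hiq (ENNReal.mul_ne_top
      ENNReal.ofNat_ne_top (ENNReal.rpow_ne_top_of_nonneg hu0 ENNReal.ofReal_ne_top))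
    have hC := ProductMorrey.morrey_constant_ne_top (n := n) (P := P) hpq.pos hp₀ B hC₂t
    obtain ⟨C, hCeq⟩ : ∃ C : ℝ≥0, (C : ℝ≥0∞) = _ := ⟨_, ENNReal.coe_toNNReal hC⟩
    refine ⟨C, fun μ hμ K hK _ S hS f hf0 hf => ?_⟩
    rw [hCeq]
    obtain ⟨E, hE, hd⟩ := hS
    exact ProductMorrey.morreyNorm_sparseOperator_le hP hpq hpP hp₀ hμ hK hE hd hf0 hf
      (ProductMorrey.testConst_le_bumpTestConst hp hr K hμ) fun F hF g hg =>
        ProductMorrey.exists_dual_bound_of_bump hpq hr hμ K hu (fun R hR => hE R (hF hR))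
          (hd.subset hF) hg
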